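/- Let $\mathcal P$ be the set of continuous functions $\omega:\mathbb R^2\to(0,\infty)$ with $\omega(x)\to0$ as $|x|\to\infty$, $\int_{\mathbb R^2}\omega\,dx<\infty$ and $\int_{\mathbb R^2}\omega(x)\log(1+|x|)\,dx<\infty$. For $\omega\in\mathcal P$ and $a>0$ let $h(a,\omega)=|\{x:\omega(x)>a\}|$ (Lebesgue measure) and $$E(\omega)=-\frac1{4\pi}\int_{\mathbb R^2}\int_{\mathbb R^2}\log|x-y|\,\omega(x)\,\omega(y)\,dx\,dy .$$ For $\mathcal Q\subseteq\mathcal P$ and $\bar\omega\in\mathcal P$ let $\mathcal O_{\bar\omega}(\mathcal Q)=\{\omega\in\mathcal Q:\ h(a,\omega)=h(a,\bar\omega)\text{ for all }a>0\}$. Let $\bar\omega\in\mathcal P$, let $m=\sup\bar\omega$, $\check h(a)=\pi^{-1}h(a,\bar\omega)$, $M_0=\int_{\mathbb R^2}\bar\omega\,dx$ and $L(R,S)=-RS\log\max(R,S)-\tfrac12\min(R,S)^2$. Then the supremum $m$ is attained, $M_0=\pi\int_0^m\check h(a)\,da$, the double integral defining $E(\omega)$ converges absolutely for every $\omega\in\mathcal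 O_{\bar\omega}(\mathcal P)$, the function $(a,b)\mapsto L(\check h(a),\check h(b))$ is integrable on $[0,m]^2$, and the maximum of $E$ over $\mathcal O_{\bar\omega}(\mathcal P)$ exists and equals $$\max_{\omega\in\mathcal O_{\bar\omega}(\mathcal P)}E(\omega)=\frac{\pi}{8}\int_0^m\!\!\int_0^m L(\check h(a),\check h(b))\,da\,db+\frac{1}{8\pi}M_0^2 .$$ The maximum is attained at an element of $\mathcal O_{\bar\omega}(\mathcal P)$ that is radially symmetric and nonincreasing in the radial direction. Moreover, for every $\mathcal Q\subseteq\mathcal P$ (for instance the $C^\infty$ functions in $\mathcal P$, or those with a prescribed faster decay) such that $\mathcal O_{\bar\omega}(\mathcal Q)$ contains a radially symmetric function that is nonincreasing in the radial direction, the maximum of $E$ over $\mathcal O_{\bar\omega}(\mathcal Q)$ exists and has the same value. -/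

import Mathlib

open Set Filter Topology MeasureTheory

noncomputable section

namespace PlanarVortex

/-- The plane `ℝ²` with its Euclidean norm and Lebesgue measure. -/
abbrev Plane : Type := EuclideanSpace ℝ (Fin 2)

/-- The phase space: continuous, strictly positive vorticity distributions on the plane that tend
to `0` at infinity, with finite mass and finite logarithmic moment. The last two conditions are
the decay needed for the energy to be well defined. -/
def phaseSpace : Set (Plane → ℝ) :=
  {ω | Continuous ω ∧ (∀ x, 0 < ω x) ∧ Tendsto ω (cocompact Plane) (𝓝 0) ∧
    Integrable ω ∧ Integrable fun x => Real.log (1 + ‖x‖) * ω x}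

/-- The elementary Casimir functional `h(a, ω) = |{ω > a}|`. -/
def h (a : ℝ) (ω : Plane → ℝ) : ENNReal := volume {x | a < ω x}

/-- The rearrangement orbit of `ω₀` within a class `Q` of functions: the elements of `Q` whose
superlevel sets have the same areas as those of `ω₀`. -/
def orbit (Q : Set (Plane → ℝ)) (ω₀ : Plane → ℝ) : Set (Plane → ℝ) :=
  {ω ∈ Q | ∀ a : ℝ, 0 < a → h a ω = h a ω₀}

/-- Radially symmetric and nonincreasing in the radial direction (exchanging `x` and `y` shows
that `ω x` depends on `‖x‖` only). -/
def IsSymmDecreasing (ω : Plane → ℝ) : Prop := ∀ x y, ‖x‖ ≤ ‖y‖ → ω y ≤ ω x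

/-- The mass `M₀(ω) = ∫ ω`. -/
def mass (ω : Plane → ℝ) : ℝ := ∫ x, ω x

/-- The energy `E(ω) = -(4π)⁻¹ ∫∫ log|x-y| ω(x) ω(y) dx dy`. -/
def energy (ω : Plane → ℝ) : ℝ :=
  -(1 / (4 * Real.pi)) * ∫ x, ∫ y, Real.log ‖x - y‖ * ω x * ω y

/-- The normalized constraint function `π⁻¹ |{ω > a}|`. -/
def hNorm (ω : Plane → ℝ) (a : ℝ) : ℝ := Real.pi⁻¹ * (h a ω).toReal

/-- The kernel `L(R,S) = -R S log max(R,S) - min(R,S)² / 2`. -/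
def L (R S : ℝ) : ℝ := -(R * S * Real.log (max R S)) - 1 / 2 * (min R S) ^ 2

/-- `(π/8) ∫₀ᵐ ∫₀ᵐ L(ȟ(a), ȟ(b)) da db + M₀² / (8π)`, where `ȟ = hNorm ω`, `M₀ = mass ω`. -/
def energyFormula (ω : Plane → ℝ) (m : ℝ) : ℝ :=
  Real.pi / 8 * (∫ a in (0 : ℝ)..m, ∫ b in (0 : ℝ)..m, L (hNorm ω a) (hNorm ω b)) +
    1 / (8 * Real.pi) * mass ω ^ 2

end PlanarVortex

end

open Set Filter Topology MeasureTheory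

noncomputable section

namespace PlanarVortex


/-! The upper bound is a Riesz rearrangement inequality, proved by polarization. Since `-log|x-y|`
decreases with distance, moving the larger of `g x`, `g (σ x)` to one side of a line, where `σ` is
the reflection in it, cannot lower the energy (`energy_le_energy_polarize`). It preserves the areas
of superlevel sets and any modulus of continuity. If the chosen side contains the origin, it does
not raise the moment `∫ log(1+|x|) g` either.

Fix a modulus of continuity of `ω` and consider the rearrangements of `ω` with that modulus, with no
less energy and no larger moment (`Improvement`). The modulus gives equicontinuity, and the moment
bound prevents mass from escaping to infinity, so sequences have uniform limits. Along these the
moment is lower and the energy upper semicontinuous, hence some improvement has least moment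
(`exists_improvement_min`). Polarizing it in any line off the origin gives another improvement, so
its moment cannot drop; the equality case shows that no reflection away from the origin increases
its values, which forces it to be symmetric decreasing. Thus every element of the orbit is dominated
in energy by a symmetric decreasing one (`exists_symmDecreasing_energy_le`).

All symmetric decreasing elements of the orbit have the same energy. Their superlevel sets are
centred discs of area `π ȟ(a)`, and the layer-cake formula turns the energy into an integral over
pairs of levels of the interaction of two concentric discs. By Newton's theorem this is
`-(π²/2)(L(r,s) + rs)` (`integral_ball_ball_log_eq_L`): the `L` part gives the double integral,
while `rs` factorizes and gives `M₀²/(8π)`. -/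

/-- Bounded continuous nonnegative functions with finite mass and finite logarithmic moment. -/
structure Admissible (g : Plane → ℝ) : Prop where
  cont : Continuous g
  nonneg : ∀ x, 0 ≤ g x
  bdd : ∃ C, ∀ x, g x ≤ C
  int : Integrable g
  logInt : Integrable fun x => Real.log (1 + ‖x‖) * g x

/-! ### Integrability of the logarithmic interaction -/

lemma log_one_add_norm_nonneg (x : Plane) : 0 ≤ Real.log (1 + ‖x‖) :=
  Real.log_nonneg (by linarith [norm_nonneg x])

lemma continuous_log_one_add_norm : Continuous fun x : Plane => Real.log (1 + ‖x‖) :=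
  (continuous_const.add continuous_norm).log fun x => (add_pos_of_pos_of_nonneg one_pos (norm_nonneg x)).ne'

lemma measurable_posLog : Measurable Real.posLog :=
  measurable_const.max Real.measurable_log

/-- In polar coordinates the integrand is `t log⁺(1/t)`, which is at most `1` on `(0,1]` and
vanishes beyond. -/
lemma integrable_posLog_inv_norm : Integrable fun z : Plane => Real.posLog ‖z‖⁻¹ := by
  rw [integrable_fun_norm_addHaar volume (f := fun t => Real.posLog t⁻¹)]
  have hfin : Module.finrank ℝ Plane - 1 = 1 := by simp
  simp only [hfin, pow_one, smul_eq_mul]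
  have h1 : Integrable ((Ioc (0 : ℝ) 1).indicator fun _ => (1 : ℝ)) := by
    rw [integrable_indicator_iff measurableSet_Ioc]
    exact integrableOn_const (by simp)
  refine (h1.integrableOn (s := Ioi 0)).mono' ?_ ?_
  · exact (measurable_id.mul (measurable_posLog.comp measurable_inv)).aestronglyMeasurable
  · refine (ae_restrict_iff' measurableSet_Ioi).2 (Eventually.of_forall fun t ht => ?_)
    have ht : 0 < t := ht
    rw [Real.norm_of_nonneg (mul_nonneg ht.le Real.posLog_nonneg)]
    by_cases h : t ≤ 1
    · rw [indicator_of_mem (show t ∈ Ioc (0 : ℝ) 1 from ⟨ht, h⟩)]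
      rw [Real.posLog_eq_log (by rw [abs_of_pos (by positivity)]; exact (one_le_inv₀ ht).2 h)]
      have := Real.log_le_sub_one_of_pos (inv_pos.2 ht)
      calc t * Real.log t⁻¹ ≤ t * (t⁻¹ - 1) := by gcongr
        _ = 1 - t := by field_simp
        _ ≤ 1 := by linarith
    · rw [indicator_of_notMem (fun h' => h h'.2)]
      push Not at h
      rw [(Real.posLog_eq_zero_iff _).2, mul_zero]
      rw [abs_of_pos (by positivity)]
      exact (inv_le_one₀ ht).2 h.le

lemma posLog_norm_sub_le (x y : Plane) :
    Real.posLog ‖x - y‖ ≤ Real.log (1 + ‖x‖) + Real.log (1 + ‖y‖) := by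
  rw [← Real.log_mul (by positivity) (by positivity)]
  refine max_le (Real.log_nonneg ?_) ?_
  · nlinarith [norm_nonneg x, norm_nonneg y, mul_nonneg (norm_nonneg x) (norm_nonneg y)]
  · rcases (norm_nonneg (x - y)).eq_or_lt with h | h
    · rw [← h, Real.log_zero]
      exact Real.log_nonneg
        (by nlinarith [norm_nonneg x, norm_nonneg y, mul_nonneg (norm_nonneg x) (norm_nonneg y)])
    · refine Real.log_le_log h ?_
      nlinarith [norm_sub_le x y, mul_nonneg (norm_nonneg x) (norm_nonneg y)]

lemma abs_log_le_posLog_add (t : ℝ) : |Real.log t| ≤ Real.posLog t⁻¹ + Real.posLog t := by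
  rw [← Real.posLog_sub_posLog_inv]
  have h1 : 0 ≤ Real.posLog t := Real.posLog_nonneg
  have h2 : 0 ≤ Real.posLog t⁻¹ := Real.posLog_nonneg
  rw [abs_le]; constructor <;> linarith

/-- The integrand of the energy. -/
def energyDensity (g : Plane → ℝ) (p : Plane × Plane) : ℝ :=
  Real.log ‖p.1 - p.2‖ * g p.1 * g p.2

lemma measurable_energyDensity {g : Plane → ℝ} (hg : Continuous g) :
    Measurable (energyDensity g) := by
  refine ((Real.measurable_log.comp (measurable_fst.sub measurable_snd).norm).mul
    (hg.measurable.comp measurable_fst)).mul (hg.measurable.comp measurable_snd)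

/-- Bounding one factor `g` by its supremum leaves the convolution integrand of two integrable
functions. -/
lemma Admissible.integrable_posLog_inv {g : Plane → ℝ} (hg : Admissible g) :
    Integrable fun p : Plane × Plane => Real.posLog ‖p.1 - p.2‖⁻¹ * g p.1 * g p.2 := by
  obtain ⟨C, hC⟩ := hg.bdd
  have h1 := (hg.int.convolution_integrand (μ := volume) (ContinuousLinearMap.mul ℝ ℝ)
    integrable_posLog_inv_norm).const_mul C
  refine h1.mono' ?_ (Eventually.of_forall fun p => ?_)
  · exact (((measurable_posLog.comp (measurable_fst.sub measurable_snd).norm.inv).mul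
      (hg.cont.measurable.comp measurable_fst)).mul
      (hg.cont.measurable.comp measurable_snd)).aestronglyMeasurable
  · have h2 : 0 ≤ Real.posLog ‖p.1 - p.2‖⁻¹ := Real.posLog_nonneg
    have h3 := hg.nonneg p.1
    have h4 := hg.nonneg p.2
    rw [Real.norm_of_nonneg (by positivity), ContinuousLinearMap.mul_apply']
    calc Real.posLog ‖p.1 - p.2‖⁻¹ * g p.1 * g p.2
        ≤ Real.posLog ‖p.1 - p.2‖⁻¹ * C * g p.2 := by gcongr; exact hC _
      _ = _ := by ring

lemma Admissible.integrable_posLog {g : Plane → ℝ} (hg : Admissible g) :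
    Integrable fun p : Plane × Plane => Real.posLog ‖p.1 - p.2‖ * g p.1 * g p.2 := by
  refine ((hg.logInt.mul_prod hg.int).add (hg.int.mul_prod hg.logInt)).mono' ?_
    (Eventually.of_forall fun p => ?_)
  · exact (((measurable_posLog.comp (measurable_fst.sub measurable_snd).norm).mul
      (hg.cont.measurable.comp measurable_fst)).mul
      (hg.cont.measurable.comp measurable_snd)).aestronglyMeasurable
  · have h2 : 0 ≤ Real.posLog ‖p.1 - p.2‖ := Real.posLog_nonneg
    have h3 := hg.nonneg p.1
    have h4 := hg.nonneg p.2
    rw [Real.norm_of_nonneg (by positivity)]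
    calc Real.posLog ‖p.1 - p.2‖ * g p.1 * g p.2
        ≤ (Real.log (1 + ‖p.1‖) + Real.log (1 + ‖p.2‖)) * g p.1 * g p.2 := by
          gcongr; exact posLog_norm_sub_le _ _
      _ = _ := by simp only [Pi.add_apply]; ring

lemma energyDensity_eq (g : Plane → ℝ) (p : Plane × Plane) :
    energyDensity g p = Real.posLog ‖p.1 - p.2‖ * g p.1 * g p.2 -
      Real.posLog ‖p.1 - p.2‖⁻¹ * g p.1 * g p.2 := by
  rw [energyDensity, ← Real.posLog_sub_posLog_inv]; ring

lemma Admissible.integrable_energyDensity {g : Plane → ℝ} (hg : Admissible g) :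
    Integrable (energyDensity g) :=
  (hg.integrable_posLog.sub hg.integrable_posLog_inv).congr
    (Eventually.of_forall fun p => (energyDensity_eq g p).symm)

lemma Admissible.energy_eq {g : Plane → ℝ} (hg : Admissible g) :
    energy g = -(1 / (4 * Real.pi)) * ∫ p, energyDensity g p := by
  rw [energy]
  congr 1
  exact (integral_prod _ hg.integrable_energyDensity).symm

lemma Admissible.energy_le_energy_iff {f g : Plane → ℝ} (hf : Admissible f) (hg : Admissible g) :
    energy f ≤ energy g ↔ ∫ p, energyDensity g p ≤ ∫ p, energyDensity f p := by
  rw [hf.energy_eq, hg.energy_eq]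
  have : 0 < 1 / (4 * Real.pi) := by positivity
  constructor
  · intro h; nlinarith
  · intro h; nlinarith

/-- A continuous function vanishing at infinity and positive everywhere attains its maximum. -/
lemma exists_max_of_mem_phaseSpace {ω : Plane → ℝ} (hω : ω ∈ phaseSpace) :
    ∃ x, ∀ y, ω y ≤ ω x := by
  refine hω.1.exists_forall_ge' 0 ?_
  exact (hω.2.2.1.eventually (ge_mem_nhds (hω.2.1 0)))

lemma admissible_of_mem_phaseSpace {ω : Plane → ℝ} (hω : ω ∈ phaseSpace) : Admissible ω where
  cont := hω.1
  nonneg x := (hω.2.1 x).le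
  bdd := let ⟨x, hx⟩ := exists_max_of_mem_phaseSpace hω; ⟨ω x, hx⟩
  int := hω.2.2.2.1
  logInt := hω.2.2.2.2


/-! ### Reflections and polarization -/

/-- Signed distance to the line `⟪x, u⟫ = c` (for a unit vector `u`). -/
def lineDist (u : Plane) (c : ℝ) (x : Plane) : ℝ := inner ℝ x u - c

/-- Reflection in the line `⟪x, u⟫ = c` (for a unit vector `u`). -/
def lineRefl (u : Plane) (c : ℝ) (x : Plane) : Plane := x - (2 * lineDist u c x) • u

/-- Two-point symmetrization with respect to the half-plane `⟪x, u⟫ ≤ c`. -/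
def polarize (u : Plane) (c : ℝ) (g : Plane → ℝ) (x : Plane) : ℝ :=
  if lineDist u c x ≤ 0 then max (g x) (g (lineRefl u c x)) else min (g x) (g (lineRefl u c x))

section Polarize

variable {u : Plane} {c : ℝ} {g : Plane → ℝ}

lemma lineDist_lineRefl (hu : ‖u‖ = 1) (x : Plane) :
    lineDist u c (lineRefl u c x) = -lineDist u c x := by
  have h : inner ℝ u u = (1 : ℝ) := by rw [real_inner_self_eq_norm_sq, hu, one_pow]
  simp only [lineDist, lineRefl, inner_sub_left, inner_smul_left, h]
  simp
  ring

lemma lineRefl_lineRefl (hu : ‖u‖ = 1) (x : Plane) : lineRefl u c (lineRefl u c x) = x := by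
  rw [lineRefl, lineDist_lineRefl hu, lineRefl]
  module

lemma lineRefl_of_lineDist_eq_zero {x : Plane} (hx : lineDist u c x = 0) :
    lineRefl u c x = x := by
  simp [lineRefl, hx]

lemma continuous_lineDist : Continuous (lineDist u c) := by
  unfold lineDist; fun_prop

lemma continuous_lineRefl : Continuous (lineRefl u c) := by
  unfold lineRefl; have := continuous_lineDist (u := u) (c := c); fun_prop

lemma lineRefl_eq_reflection (hu : ‖u‖ = 1) (x : Plane) :
    lineRefl u c x = (ℝ ∙ u)ᗮ.reflection x + (2 * c) • u := by
  rw [Submodule.reflection_orthogonal_apply, Submodule.reflection_singleton_apply, hu, lineRefl,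
    lineDist, real_inner_comm]
  simp only [RCLike.ofReal_real_eq_id, id, one_pow, div_one]
  module

lemma measurePreserving_lineRefl (hu : ‖u‖ = 1) : MeasurePreserving (lineRefl u c) := by
  have h := (measurePreserving_add_right volume ((2 * c) • u)).comp
    ((ℝ ∙ u)ᗮ.reflection : Plane ≃ₗᵢ[ℝ] Plane).measurePreserving
  rw [show lineRefl u c = (fun x => x + (2 * c) • u) ∘ (ℝ ∙ u)ᗮ.reflection from
    funext (lineRefl_eq_reflection hu)]
  exact h

lemma norm_lineRefl_sub_lineRefl (hu : ‖u‖ = 1) (x y : Plane) :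
    ‖lineRefl u c x - lineRefl u c y‖ = ‖x - y‖ := by
  rw [lineRefl_eq_reflection hu, lineRefl_eq_reflection hu, add_sub_add_right_eq_sub, ← map_sub,
    LinearIsometryEquiv.norm_map]

lemma norm_lineRefl_sub (hu : ‖u‖ = 1) (x y : Plane) :
    ‖lineRefl u c x - y‖ = ‖x - lineRefl u c y‖ := by
  conv_lhs => rw [← lineRefl_lineRefl (c := c) hu y]
  exact norm_lineRefl_sub_lineRefl hu _ _

/-- This identity is the source of every distance comparison below: reflecting one of two points
increases their distance when they lie on the same side and decreases it when they lie on opposite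
sides. -/
lemma norm_sub_lineRefl_sq (hu : ‖u‖ = 1) (x y : Plane) :
    ‖x - lineRefl u c y‖ ^ 2 = ‖x - y‖ ^ 2 + 4 * (lineDist u c x * lineDist u c y) := by
  have h : x - lineRefl u c y = (x - y) + (2 * lineDist u c y) • u := by rw [lineRefl]; abel
  rw [h, norm_add_sq_real, norm_smul, hu, inner_smul_right, inner_sub_left, Real.norm_eq_abs,
    mul_one, sq_abs]
  have h1 : inner ℝ x u = lineDist u c x + c := by simp [lineDist]
  have h2 : inner ℝ y u = lineDist u c y + c := by simp [lineDist]
  rw [h1, h2]; ring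

lemma norm_sub_lineRefl_le (hu : ‖u‖ = 1) {x y : Plane}
    (h : lineDist u c x * lineDist u c y ≤ 0) : ‖x - lineRefl u c y‖ ≤ ‖x - y‖ := by
  have := norm_sub_lineRefl_sq (c := c) hu x y
  exact (sq_le_sq₀ (norm_nonneg _) (norm_nonneg _)).1 (by linarith)

lemma norm_lineRefl_sq (hu : ‖u‖ = 1) (x : Plane) :
    ‖lineRefl u c x‖ ^ 2 = ‖x‖ ^ 2 - 4 * c * lineDist u c x := by
  have := norm_sub_lineRefl_sq (c := c) hu 0 x
  simp only [zero_sub, norm_neg] at this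
  rw [this]; simp [lineDist]; ring

/-- On each reflected pair, polarization either keeps or swaps the two values, so any symmetric
expression in the pair is unchanged. -/
lemma polarize_cases (hu : ‖u‖ = 1) (x : Plane) :
    (polarize u c g x = g x ∧ polarize u c g (lineRefl u c x) = g (lineRefl u c x)) ∨
      (polarize u c g x = g (lineRefl u c x) ∧ polarize u c g (lineRefl u c x) = g x) := by
  simp only [polarize, lineDist_lineRefl hu, lineRefl_lineRefl hu]
  rcases lt_trichotomy (lineDist u c x) 0 with h | h | h
  · rw [if_pos h.le, if_neg (by linarith)]
    rcases le_total (g x) (g (lineRefl u c x)) with h' | h' <;> simp [h']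
  · simp [lineRefl_of_lineDist_eq_zero h]
  · rw [if_neg (by linarith), if_pos (by linarith)]
    rcases le_total (g x) (g (lineRefl u c x)) with h' | h' <;> simp [h']

lemma polarize_add (hu : ‖u‖ = 1) (x : Plane) :
    polarize u c g x + polarize u c g (lineRefl u c x) = g x + g (lineRefl u c x) := by
  rcases polarize_cases (g := g) (c := c) hu x with h | h <;> rw [h.1, h.2]
  ring

lemma polarize_sub_of_neg (hu : ‖u‖ = 1) {x : Plane} (hx : lineDist u c x < 0) :
    polarize u c g x - polarize u c g (lineRefl u c x) = |g x - g (lineRefl u c x)| := by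
  simp only [polarize, lineDist_lineRefl hu, lineRefl_lineRefl hu]
  rw [if_pos hx.le, if_neg (by linarith), min_comm, max_sub_min_eq_abs, abs_sub_comm]

lemma polarize_sub_of_pos (hu : ‖u‖ = 1) {x : Plane} (hx : 0 < lineDist u c x) :
    polarize u c g x - polarize u c g (lineRefl u c x) = -|g x - g (lineRefl u c x)| := by
  have := polarize_sub_of_neg (c := c) (g := g) hu (x := lineRefl u c x)
    (by rw [lineDist_lineRefl hu]; linarith)
  rw [lineRefl_lineRefl hu, abs_sub_comm] at this
  linarith

lemma polarize_nonneg (hg : ∀ x, 0 ≤ g x) (x : Plane) : 0 ≤ polarize u c g x := by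
  unfold polarize
  split_ifs
  · exact le_max_of_le_left (hg x)
  · exact le_min (hg x) (hg _)

/-- For points on the same side, `max` and `min` are nonexpansive. For points on opposite sides,
reflecting one of them brings the two closer, so the mixed differences are also at most `ε`. -/
lemma abs_polarize_sub_le (hu : ‖u‖ = 1) {d ε : ℝ} (hg : ∀ x y, ‖x - y‖ ≤ d → |g x - g y| ≤ ε)
    (x y : Plane) (hxy : ‖x - y‖ ≤ d) : |polarize u c g x - polarize u c g y| ≤ ε := by
  have h1 := hg x y hxy
  have h2 := hg (lineRefl u c x) (lineRefl u c y) (by rwa [norm_lineRefl_sub_lineRefl hu])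
  have h3 : lineDist u c x * lineDist u c y ≤ 0 → |g x - g (lineRefl u c y)| ≤ ε := fun h =>
    hg _ _ (le_trans (norm_sub_lineRefl_le hu h) hxy)
  have h4 : lineDist u c x * lineDist u c y ≤ 0 → |g (lineRefl u c x) - g y| ≤ ε := fun h =>
    hg _ _ (by
      rw [norm_lineRefl_sub hu]
      exact le_trans (norm_sub_lineRefl_le hu h) hxy)
  rw [abs_le] at h1 h2
  simp only [abs_le] at h3 h4
  unfold polarize
  split_ifs with hx hy hy
  · rw [abs_le]; constructor <;>
    rcases max_cases (g x) (g (lineRefl u c x)) with k | k <;>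
    rcases max_cases (g y) (g (lineRefl u c y)) with l | l <;> rw [k.1, l.1] <;> linarith
  · have h : lineDist u c x * lineDist u c y ≤ 0 := by nlinarith
    have h3 := h3 h
    have h4 := h4 h
    rw [abs_le]; constructor <;>
    rcases max_cases (g x) (g (lineRefl u c x)) with k | k <;>
    rcases min_cases (g y) (g (lineRefl u c y)) with l | l <;> rw [k.1, l.1] <;> linarith
  · have h : lineDist u c x * lineDist u c y ≤ 0 := by nlinarith
    have h3 := h3 h
    have h4 := h4 h
    rw [abs_le]; constructor <;>
    rcases min_cases (g x) (g (lineRefl u c x)) with k | k <;>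
    rcases max_cases (g y) (g (lineRefl u c y)) with l | l <;> rw [k.1, l.1] <;> linarith
  · rw [abs_le]; constructor <;>
    rcases min_cases (g x) (g (lineRefl u c x)) with k | k <;>
    rcases min_cases (g y) (g (lineRefl u c y)) with l | l <;> rw [k.1, l.1] <;> linarith

/-- Twice the area is the integral of the indicator summed over reflected pairs, and that sum does
not see a swap. -/
lemma h_polarize (hu : ‖u‖ = 1) (hg : Continuous g) (hp : Continuous (polarize u c g)) (a : ℝ) :
    h a (polarize u c g) = h a g := by
  have key : ∀ f : Plane → ℝ, Continuous f →
      2 * h a f = ∫⁻ x, ({x | a < f x}.indicator 1 x + {x | a < f x}.indicator 1 (lineRefl u c x) :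
        ENNReal) := by
    intro f hf
    have hm : MeasurableSet {x | a < f x} := measurableSet_lt measurable_const hf.measurable
    have hm' : Measurable ({x | a < f x}.indicator (1 : Plane → ENNReal)) :=
      measurable_one.indicator hm
    rw [lintegral_add_left hm', (measurePreserving_lineRefl hu).lintegral_comp hm',
      lintegral_indicator_one hm, two_mul]
    rfl
  have h2 : 2 * h a (polarize u c g) = 2 * h a g := by
    rw [key _ hp, key _ hg]
    refine lintegral_congr fun x => ?_
    rcases polarize_cases (g := g) (c := c) hu x with h | h
    · simp only [indicator_apply, mem_ofPred_eq, h.1, h.2]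
    · simp only [indicator_apply, mem_ofPred_eq, h.1, h.2, Pi.one_apply]
      rw [add_comm]
  exact (ENNReal.mul_right_inj (by simp) (by simp)).1 h2

end Polarize


/-! ### Effect of polarization on the energy and the logarithmic moment -/

section PolarizeEnergy

variable {u : Plane} {c : ℝ} {g : Plane → ℝ}

/-- Graphs are null sets. This discards the diagonal and the reflected diagonal, where the value
`Real.log 0 = 0` spoils monotonicity of the kernel. -/
lemma ae_snd_ne {f : Plane → Plane} (hf : Continuous f) :
    ∀ᵐ p : Plane × Plane, p.2 ≠ f p.1 := by
  have hm : MeasurableSet {p : Plane × Plane | p.2 = f p.1} :=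
    (isClosed_eq continuous_snd (hf.comp continuous_fst)).measurableSet
  rw [ae_iff]
  simp only [ne_eq, not_not]
  rw [Measure.volume_eq_prod, Measure.measure_prod_null hm]
  refine Eventually.of_forall fun x => ?_
  simp [preimage]

/-- If the signs of `k₁ - k₂` and `εδ` are opposite then replacing the odd parts `d, e` by
`ε|d|, δ|e|` decreases the four-point sum. -/
lemma fourPoint_le {k₁ k₂ a a' b b' A A' B B' : ℝ} (ha : A + A' = a + a') (hb : B + B' = b + b')
    (h : (k₁ - k₂) * ((A - A') * (B - B')) ≤ (k₁ - k₂) * ((a - a') * (b - b'))) :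
    k₁ * A * B + k₂ * A' * B + (k₂ * A * B' + k₁ * A' * B') ≤
      k₁ * a * b + k₂ * a' * b + (k₂ * a * b' + k₁ * a' * b') := by
  -- Splitting into even and odd parts under reflection diagonalizes the form; only the odd term
  -- changes under polarization.
  have e : ∀ x x' y y' : ℝ, k₁ * x * y + k₂ * x' * y + (k₂ * x * y' + k₁ * x' * y') =
      (k₁ + k₂) / 2 * ((x + x') * (y + y')) + (k₁ - k₂) * ((x - x') * (y - y')) / 2 := by
    intros; ring
  rw [e, e, ha, hb]
  linarith

lemma mul_abs_le_of_nonneg {k d e : ℝ} (hk : 0 ≤ k) : k * (-(|d| * |e|)) ≤ k * (d * e) := by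
  rw [← abs_mul]
  exact mul_le_mul_of_nonneg_left (neg_abs_le _) hk

lemma mul_abs_le_of_nonpos {k d e : ℝ} (hk : k ≤ 0) : k * (|d| * |e|) ≤ k * (d * e) := by
  rw [← abs_mul]
  exact mul_le_mul_of_nonpos_left (le_abs_self _) hk

lemma log_norm_sub_le_of_pos (hu : ‖u‖ = 1) {x y : Plane} (hxy : x ≠ y)
    (h : 0 ≤ lineDist u c x * lineDist u c y) :
    Real.log ‖x - y‖ - Real.log ‖x - lineRefl u c y‖ ≤ 0 := by
  have h1 := norm_sub_lineRefl_sq (c := c) hu x y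
  have h2 : 0 < ‖x - y‖ := norm_pos_iff.2 (sub_ne_zero.2 hxy)
  rw [sub_nonpos]
  exact Real.log_le_log h2 ((sq_le_sq₀ (norm_nonneg _) (norm_nonneg _)).1 (by linarith))

lemma log_norm_sub_le_of_neg (hu : ‖u‖ = 1) {x y : Plane} (hxy : x ≠ lineRefl u c y)
    (h : lineDist u c x * lineDist u c y ≤ 0) :
    0 ≤ Real.log ‖x - y‖ - Real.log ‖x - lineRefl u c y‖ := by
  have h2 : 0 < ‖x - lineRefl u c y‖ := norm_pos_iff.2 (sub_ne_zero.2 hxy)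
  rw [sub_nonneg]
  exact Real.log_le_log h2 (norm_sub_lineRefl_le hu h)

/-- On the four pairs formed from `x`, `y` and their reflections the kernel takes two values. Their
difference has sign opposite to the product of the signed distances, while polarization gives the
odd part a fixed sign on each side. -/
lemma fourPoint_energyDensity_polarize_le (hu : ‖u‖ = 1) {x y : Plane} (hxy : x ≠ y)
    (hxy' : x ≠ lineRefl u c y) :
    energyDensity (polarize u c g) (x, y) + energyDensity (polarize u c g) (lineRefl u c x, y) +
      (energyDensity (polarize u c g) (x, lineRefl u c y) +
        energyDensity (polarize u c g) (lineRefl u c x, lineRefl u c y)) ≤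
    energyDensity g (x, y) + energyDensity g (lineRefl u c x, y) +
      (energyDensity g (x, lineRefl u c y) + energyDensity g (lineRefl u c x, lineRefl u c y)) := by
  simp only [energyDensity]
  rw [norm_lineRefl_sub hu, norm_lineRefl_sub_lineRefl hu]
  refine fourPoint_le (polarize_add hu x) (polarize_add hu y) ?_
  rcases lt_trichotomy (lineDist u c x) 0 with hx | hx | hx
  · rcases lt_trichotomy (lineDist u c y) 0 with hy | hy | hy
    · rw [polarize_sub_of_neg hu hx, polarize_sub_of_neg hu hy]
      exact mul_abs_le_of_nonpos (log_norm_sub_le_of_pos hu hxy (by nlinarith))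
    · simp [lineRefl_of_lineDist_eq_zero hy]
    · rw [polarize_sub_of_neg hu hx, polarize_sub_of_pos hu hy, mul_neg]
      exact mul_abs_le_of_nonneg (log_norm_sub_le_of_neg hu hxy' (by nlinarith))
  · simp [lineRefl_of_lineDist_eq_zero hx]
  · rcases lt_trichotomy (lineDist u c y) 0 with hy | hy | hy
    · rw [polarize_sub_of_pos hu hx, polarize_sub_of_neg hu hy, neg_mul]
      exact mul_abs_le_of_nonneg (log_norm_sub_le_of_neg hu hxy' (by nlinarith))
    · simp [lineRefl_of_lineDist_eq_zero hy]
    · rw [polarize_sub_of_pos hu hx, polarize_sub_of_pos hu hy, neg_mul_neg]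
      exact mul_abs_le_of_nonpos (log_norm_sub_le_of_pos hu hxy (by nlinarith))

lemma integral_fourPoint (hu : ‖u‖ = 1) {F : Plane × Plane → ℝ} (hm : Measurable F)
    (hF : Integrable F) :
    Integrable (fun p : Plane × Plane => F (p.1, p.2) + F (lineRefl u c p.1, p.2) +
      (F (p.1, lineRefl u c p.2) + F (lineRefl u c p.1, lineRefl u c p.2))) ∧
    ∫ p : Plane × Plane, (F (p.1, p.2) + F (lineRefl u c p.1, p.2) +
      (F (p.1, lineRefl u c p.2) + F (lineRefl u c p.1, lineRefl u c p.2))) = 4 * ∫ p, F p := by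
  have hσ := measurePreserving_lineRefl (c := c) hu
  have hid := MeasurePreserving.id (volume : Measure Plane)
  have key : ∀ T : Plane × Plane → Plane × Plane, MeasurePreserving T →
      Integrable (fun p => F (T p)) ∧ ∫ p, F (T p) = ∫ p, F p := by
    intro T hT
    refine ⟨hT.integrable_comp_of_integrable hF, ?_⟩
    have := integral_map (μ := volume) hT.measurable.aemeasurable (f := F)
      hm.aestronglyMeasurable
    rw [← this, hT.map_eq]
  obtain ⟨i1, e1⟩ := key (fun p => (lineRefl u c p.1, p.2)) (hσ.prod hid)
  obtain ⟨i2, e2⟩ := key (fun p => (p.1, lineRefl u c p.2)) (hid.prod hσ)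
  obtain ⟨i3, e3⟩ := key (fun p => (lineRefl u c p.1, lineRefl u c p.2)) (hσ.prod hσ)
  refine ⟨(hF.add i1).add (i2.add i3), ?_⟩
  have e := integral_add (hF.add i1) (i2.add i3)
  have e' := integral_add hF i1
  have e'' := integral_add i2 i3
  simp only [Pi.add_apply] at e e' e''
  simp only [Prod.mk.eta]
  rw [e, e', e'', e1, e2, e3]
  ring

lemma energy_le_energy_polarize (hu : ‖u‖ = 1) (hg : Admissible g)
    (hp : Admissible (polarize u c g)) : energy g ≤ energy (polarize u c g) := by
  rw [hg.energy_le_energy_iff hp]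
  obtain ⟨i1, e1⟩ := integral_fourPoint (c := c) hu (measurable_energyDensity hg.cont)
    hg.integrable_energyDensity
  obtain ⟨i2, e2⟩ := integral_fourPoint (c := c) hu (measurable_energyDensity hp.cont)
    hp.integrable_energyDensity
  have : 4 * ∫ p, energyDensity (polarize u c g) p ≤ 4 * ∫ p, energyDensity g p := by
    rw [← e1, ← e2]
    refine integral_mono_ae i2 i1 ?_
    filter_upwards [ae_snd_ne continuous_id, ae_snd_ne (continuous_lineRefl (u := u) (c := c))]
      with p h1 h2
    refine fourPoint_energyDensity_polarize_le hu (Ne.symm h1) fun h => h2 ?_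
    rw [h, lineRefl_lineRefl hu]
  linarith

/-- As `0 ≤ c`, the origin lies in the half-plane receiving the larger values, so the weight
`log(1+|x|)` is the smaller one there. -/
lemma twoPoint_log_polarize_le (hu : ‖u‖ = 1) (hc : 0 ≤ c) (x : Plane) :
    Real.log (1 + ‖x‖) * polarize u c g x +
      Real.log (1 + ‖lineRefl u c x‖) * polarize u c g (lineRefl u c x) ≤
    Real.log (1 + ‖x‖) * g x + Real.log (1 + ‖lineRefl u c x‖) * g (lineRefl u c x) := by
  have e : ∀ k k' y y' : ℝ, k * y + k' * y' = (k + k') / 2 * (y + y') + (k - k') * (y - y') / 2 := by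
    intros; ring
  rw [e, e (Real.log (1 + ‖x‖)), polarize_add hu]
  have hsq := norm_lineRefl_sq (c := c) hu x
  rcases lt_trichotomy (lineDist u c x) 0 with hx | hx | hx
  · rw [polarize_sub_of_neg hu hx]
    have h1 : ‖x‖ ≤ ‖lineRefl u c x‖ :=
      (sq_le_sq₀ (norm_nonneg _) (norm_nonneg _)).1 (by nlinarith)
    have h2 : Real.log (1 + ‖x‖) ≤ Real.log (1 + ‖lineRefl u c x‖) :=
      Real.log_le_log (by positivity) (by linarith)
    nlinarith [le_abs_self (g x - g (lineRefl u c x))]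
  · simp [lineRefl_of_lineDist_eq_zero hx]
  · rw [polarize_sub_of_pos hu hx]
    have h1 : ‖lineRefl u c x‖ ≤ ‖x‖ :=
      (sq_le_sq₀ (norm_nonneg _) (norm_nonneg _)).1 (by nlinarith)
    have h2 : Real.log (1 + ‖lineRefl u c x‖) ≤ Real.log (1 + ‖x‖) :=
      Real.log_le_log (by positivity) (by linarith)
    nlinarith [neg_abs_le (g x - g (lineRefl u c x))]

/-- The two-point inequality for the logarithmic moment is an equality at `x` in the open
half-plane only if `g` is not larger at the reflected point. -/
lemma le_of_twoPoint_log_eq (hu : ‖u‖ = 1) (hc : 0 < c) {x : Plane} (hx : lineDist u c x < 0)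
    (h : Real.log (1 + ‖x‖) * polarize u c g x +
      Real.log (1 + ‖lineRefl u c x‖) * polarize u c g (lineRefl u c x) =
    Real.log (1 + ‖x‖) * g x + Real.log (1 + ‖lineRefl u c x‖) * g (lineRefl u c x)) :
    g (lineRefl u c x) ≤ g x := by
  have e : ∀ k k' y y' : ℝ, k * y + k' * y' = (k + k') / 2 * (y + y') + (k - k') * (y - y') / 2 := by
    intros; ring
  rw [e, e (Real.log (1 + ‖x‖)), polarize_add hu, polarize_sub_of_neg hu hx] at h
  have hsq := norm_lineRefl_sq (c := c) hu x
  have h1 : ‖x‖ < ‖lineRefl u c x‖ :=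
    (sq_lt_sq₀ (norm_nonneg _) (norm_nonneg _)).1 (by nlinarith)
  have h2 : Real.log (1 + ‖x‖) < Real.log (1 + ‖lineRefl u c x‖) :=
    Real.log_lt_log (by positivity) (by linarith)
  have h3 : |g x - g (lineRefl u c x)| = g x - g (lineRefl u c x) := by
    refine mul_left_cancel₀ (sub_ne_zero.2 h2.ne) ?_
    linarith
  linarith [abs_nonneg (g x - g (lineRefl u c x))]

lemma integral_twoPoint_log (hu : ‖u‖ = 1) (hg : Admissible g) :
    Integrable (fun x => Real.log (1 + ‖x‖) * g x +
      Real.log (1 + ‖lineRefl u c x‖) * g (lineRefl u c x)) ∧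
    ∫ x, (Real.log (1 + ‖x‖) * g x + Real.log (1 + ‖lineRefl u c x‖) * g (lineRefl u c x)) =
      2 * ∫ x, Real.log (1 + ‖x‖) * g x := by
  have hσ := measurePreserving_lineRefl (c := c) hu
  have i1 := hσ.integrable_comp_of_integrable hg.logInt
  have e1 := integral_map (μ := volume) hσ.measurable.aemeasurable
    (f := fun x => Real.log (1 + ‖x‖) * g x) (continuous_log_one_add_norm.mul
      hg.cont).aestronglyMeasurable
  rw [hσ.map_eq] at e1
  refine ⟨hg.logInt.add i1, ?_⟩
  have e := integral_add hg.logInt i1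
  simp only [Function.comp_def] at e
  rw [e, ← e1, two_mul]

/-- If polarization does not decrease the logarithmic moment of `g`, then `g` is unchanged
by polarization. -/
lemma lineRefl_le_of_moment_le (hu : ‖u‖ = 1) (hc : 0 < c) (hg : Admissible g)
    (hp : Admissible (polarize u c g))
    (hle : ∫ x, Real.log (1 + ‖x‖) * g x ≤ ∫ x, Real.log (1 + ‖x‖) * polarize u c g x)
    {x : Plane} (hx : lineDist u c x < 0) : g (lineRefl u c x) ≤ g x := by
  obtain ⟨i1, e1⟩ := integral_twoPoint_log (c := c) hu hg
  obtain ⟨i2, e2⟩ := integral_twoPoint_log (c := c) hu hp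
  have hcont : ∀ f : Plane → ℝ, Continuous f → Continuous fun x => Real.log (1 + ‖x‖) * f x +
      Real.log (1 + ‖lineRefl u c x‖) * f (lineRefl u c x) := fun f hf =>
    (continuous_log_one_add_norm.mul hf).add
      ((continuous_log_one_add_norm.comp continuous_lineRefl).mul (hf.comp continuous_lineRefl))
  have hle' := fun x => twoPoint_log_polarize_le (g := g) hu hc.le x
  have h := (integral_eq_iff_of_ae_le i2 i1 (Eventually.of_forall hle')).1
    (le_antisymm (integral_mono i2 i1 hle') (by rw [e1, e2]; linarith))
  -- Equal integrals and a pointwise inequality give equality almost everywhere; continuity makes it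
  -- hold everywhere.
  have h' := (Continuous.ae_eq_iff_eq _ (hcont _ hp.cont) (hcont _ hg.cont)).1 h
  exact le_of_twoPoint_log_eq hu hc hx (congrFun h' x)

lemma integral_log_polarize_le (hu : ‖u‖ = 1) (hc : 0 ≤ c) (hg : Admissible g)
    (hp : Admissible (polarize u c g)) :
    ∫ x, Real.log (1 + ‖x‖) * polarize u c g x ≤ ∫ x, Real.log (1 + ‖x‖) * g x := by
  obtain ⟨i1, e1⟩ := integral_twoPoint_log (c := c) hu hg
  obtain ⟨i2, e2⟩ := integral_twoPoint_log (c := c) hu hp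
  have := integral_mono i2 i1 (fun x => twoPoint_log_polarize_le (g := g) hu hc x)
  rw [e1, e2] at this
  linarith

end PolarizeEnergy


/-! ### Equimeasurable functions and their limits -/

lemma lintegral_eq_of_h_eq {f g : Plane → ℝ} (hf : Continuous f) (hg : Continuous g)
    (hf0 : ∀ x, 0 ≤ f x) (hg0 : ∀ x, 0 ≤ g x) (h' : ∀ a : ℝ, 0 < a → h a f = h a g) :
    ∫⁻ x, ENNReal.ofReal (f x) = ∫⁻ x, ENNReal.ofReal (g x) := by
  rw [lintegral_eq_lintegral_meas_lt _ (Eventually.of_forall hf0) hf.measurable.aemeasurable,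
    lintegral_eq_lintegral_meas_lt _ (Eventually.of_forall hg0) hg.measurable.aemeasurable]
  exact setLIntegral_congr_fun measurableSet_Ioi fun a ha => h' a ha

lemma Admissible.mass_eq {f g : Plane → ℝ} (hf : Admissible f) (hg : Admissible g)
    (h' : ∀ a : ℝ, 0 < a → h a f = h a g) : mass f = mass g := by
  rw [mass, mass, integral_eq_lintegral_of_nonneg_ae (Eventually.of_forall hf.nonneg)
    hf.cont.aestronglyMeasurable, integral_eq_lintegral_of_nonneg_ae
    (Eventually.of_forall hg.nonneg) hg.cont.aestronglyMeasurable,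
    lintegral_eq_of_h_eq hf.cont hg.cont hf.nonneg hg.nonneg h']

lemma le_of_h_eq_zero {g : Plane → ℝ} (hg : Continuous g) {a : ℝ} (ha : h a g = 0) (x : Plane) :
    g x ≤ a := by
  by_contra! hx
  exact ((isOpen_lt continuous_const hg).measure_pos volume ⟨x, hx⟩).ne' ha

lemma h_eq_zero_of_le {g : Plane → ℝ} {a : ℝ} (ha : ∀ x, g x ≤ a) : h a g = 0 := by
  rw [h, show {x | a < g x} = ∅ from eq_empty_of_forall_notMem fun x hx => (ha x).not_gt hx,
    measure_empty]

lemma Admissible.of_h_eq {f g : Plane → ℝ} (hf : Admissible f) (hg : Continuous g)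
    (hg0 : ∀ x, 0 ≤ g x) (h' : ∀ a : ℝ, 0 < a → h a g = h a f)
    (hlog : ∫⁻ x, ENNReal.ofReal (Real.log (1 + ‖x‖) * g x) < ⊤) : Admissible g where
  cont := hg
  nonneg := hg0
  bdd := by
    obtain ⟨C, hC⟩ := hf.bdd
    -- The level must be positive, because the areas are only compared for `a > 0`.
    refine ⟨max C 1, le_of_h_eq_zero hg ?_⟩
    rw [h' _ (by positivity)]
    exact h_eq_zero_of_le fun x => (hC x).trans (le_max_left _ _)
  int := by
    refine (lintegral_ofReal_ne_top_iff_integrable hg.aestronglyMeasurable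
      (Eventually.of_forall hg0)).1 ?_
    rw [lintegral_eq_of_h_eq hg hf.cont hg0 hf.nonneg h']
    exact (lintegral_ofReal_ne_top_iff_integrable hf.cont.aestronglyMeasurable
      (Eventually.of_forall hf.nonneg)).2 hf.int
  logInt := (lintegral_ofReal_ne_top_iff_integrable
      (continuous_log_one_add_norm.mul hg).aestronglyMeasurable
      (Eventually.of_forall fun x => mul_nonneg (log_one_add_norm_nonneg x) (hg0 x))).1 hlog.ne

/-- Fatou's lemma for pointwise convergent sequences. -/
lemma lintegral_le_of_tendsto_of_le {α : Type*} [MeasurableSpace α] {μ : Measure α}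
    {F : ℕ → α → ENNReal} {G : α → ENNReal} {b : ℕ → ENNReal} {b' : ENNReal}
    (hF : ∀ n, Measurable (F n)) (hlim : ∀ x, Tendsto (fun n => F n x) atTop (𝓝 (G x)))
    (hb : ∀ n, ∫⁻ x, F n x ∂μ ≤ b n) (hb' : Tendsto b atTop (𝓝 b')) : ∫⁻ x, G x ∂μ ≤ b' := by
  calc ∫⁻ x, G x ∂μ = ∫⁻ x, liminf (fun n => F n x) atTop ∂μ := by simp only [(hlim _).liminf_eq]
    _ ≤ liminf (fun n => ∫⁻ x, F n x ∂μ) atTop := lintegral_liminf_le hF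
    _ ≤ liminf b atTop := liminf_le_liminf (Eventually.of_forall hb)
    _ = b' := hb'.liminf_eq

lemma h_le_of_forall_add {f : Plane → ℝ} {a : ℝ} {c : ENNReal}
    (hc : ∀ ε : ℝ, 0 < ε → h (a + ε) f ≤ c) : h a f ≤ c := by
  obtain ⟨v, hv, hv0, hvt⟩ := exists_seq_strictAnti_tendsto (0 : ℝ)
  have hU : {x | a < f x} = ⋃ n, {x | a + v n < f x} := by
    ext x
    simp only [mem_ofPred_eq, mem_iUnion]
    constructor
    · intro hx
      have : ∀ᶠ n in atTop, v n < f x - a := hvt.eventually (gt_mem_nhds (by linarith))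
      obtain ⟨n, hn⟩ := this.exists
      exact ⟨n, by linarith⟩
    · rintro ⟨n, hn⟩
      linarith [hv0 n]
  have hmono : Monotone fun n => {x | a + v n < f x} := by
    intro i j hij x hx
    have := hv.antitone hij
    simp only [mem_ofPred_eq] at hx ⊢
    linarith
  rw [h, hU, hmono.measure_iUnion]
  exact iSup_le fun n => hc _ (hv0 n)

/-- If `f` is within `ε` of `g`, then `{g > a+ε} ⊆ {f > a}` and `{f > a+ε} ⊆ {g > a}`. Right
continuity of the area in the level then lets `ε` tend to `0`. -/
lemma h_eq_of_forall_approx {g ω : Plane → ℝ}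
    (happ : ∀ ε : ℝ, 0 < ε → ∃ f : Plane → ℝ, (∀ x, |f x - g x| ≤ ε) ∧
      ∀ a : ℝ, 0 < a → h a f = h a ω) (a : ℝ) (ha : 0 < a) : h a g = h a ω := by
  refine le_antisymm (h_le_of_forall_add fun ε hε => ?_) (h_le_of_forall_add fun ε hε => ?_)
  · obtain ⟨f, hf, hfω⟩ := happ ε hε
    rw [← hfω a ha]
    refine measure_mono fun x hx => ?_
    have := (abs_le.1 (hf x)).1
    simp only [mem_ofPred_eq] at hx ⊢
    linarith
  · obtain ⟨f, hf, hfω⟩ := happ ε hε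
    rw [← hfω _ (by linarith)]
    refine measure_mono fun x hx => ?_
    have := (abs_le.1 (hf x)).2
    simp only [mem_ofPred_eq] at hx ⊢
    linarith

/-! ### Equicontinuity, decay and compactness -/

/-- `δ` is a modulus of continuity of `g`. -/
def HasModulus (δ : ℝ → ℝ) (g : Plane → ℝ) : Prop :=
  ∀ ε : ℝ, 0 < ε → ∀ x y, ‖x - y‖ ≤ δ ε → |g x - g y| ≤ ε

lemma HasModulus.continuous {δ : ℝ → ℝ} (hδ : ∀ ε, 0 < ε → 0 < δ ε) {g : Plane → ℝ}
    (hg : HasModulus δ g) : Continuous g := by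
  rw [Metric.continuous_iff]
  intro x ε hε
  refine ⟨δ (ε / 2), hδ _ (by linarith), fun y hy => ?_⟩
  rw [dist_eq_norm] at hy
  rw [Real.dist_eq]
  linarith [hg (ε / 2) (by linarith) y x hy.le]

lemma HasModulus.polarize {δ : ℝ → ℝ} {g : Plane → ℝ} (hg : HasModulus δ g) {u : Plane} {c : ℝ}
    (hu : ‖u‖ = 1) : HasModulus δ (polarize u c g) :=
  fun ε hε x y hxy => abs_polarize_sub_le hu (hg ε hε) x y hxy

lemma exists_hasModulus {ω : Plane → ℝ} (hω : Continuous ω)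
    (h0 : Tendsto ω (cocompact Plane) (𝓝 0)) :
    ∃ δ : ℝ → ℝ, (∀ ε, 0 < ε → 0 < δ ε) ∧ HasModulus δ ω := by
  have huc : UniformContinuous ω := hω.uniformContinuous_of_tendsto_cocompact h0
  rw [Metric.uniformContinuous_iff] at huc
  choose! δ hδ hδ' using huc
  refine ⟨fun ε => δ ε / 2, fun ε hε => half_pos (hδ ε hε), fun ε hε x y hxy => ?_⟩
  have hpos := hδ ε hε
  have := hδ' ε hε (a := x) (b := y) (by rw [dist_eq_norm]; linarith)
  rw [Real.dist_eq] at this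
  exact this.le

/-- Equicontinuity and a bound on the logarithmic moment give uniform decay at infinity. -/
lemma exists_uniform_decay {δ : ℝ → ℝ} (hδ : ∀ ε, 0 < ε → 0 < δ ε) (B : ℝ) {ε : ℝ} (hε : 0 < ε) :
    ∃ ρ : ℝ, ∀ g : Plane → ℝ, HasModulus δ g → Admissible g →
      ∫ x, Real.log (1 + ‖x‖) * g x ≤ B → ∀ x, ρ ≤ ‖x‖ → g x ≤ ε := by
  set d := δ (ε / 2) with hd
  have hd0 : 0 < d := hδ _ (half_pos hε)
  set V := volume.real (Metric.ball (0 : Plane) d) with hV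
  have hV0 : 0 < V := by
    rw [hV, Measure.real, ENNReal.toReal_pos_iff]
    exact ⟨Metric.measure_ball_pos _ _ hd0, measure_ball_lt_top⟩
  -- If `g x > ε`, then `g ≥ ε/2` on the ball of radius `d` about `x`. That ball alone contributes
  -- this much to the moment, with `r = ‖x‖`.
  have hlim : Tendsto (fun r : ℝ => Real.log (1 + (r - d)) * (ε / 2) * V) atTop atTop := by
    refine (Tendsto.atTop_mul_const (half_pos hε) ?_).atTop_mul_const hV0
    exact Real.tendsto_log_atTop.comp
      (tendsto_atTop_add_const_left _ _ (tendsto_atTop_add_const_right _ _ tendsto_id))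
  obtain ⟨ρ, hρ⟩ :=
    ((hlim.eventually_gt_atTop B).and (eventually_ge_atTop d)).exists_forall_of_atTop
  refine ⟨ρ, fun g hm hg hB x hx => ?_⟩
  obtain ⟨hρx, hdx⟩ := hρ ‖x‖ hx
  by_contra! hgx
  have hlow : ∀ y ∈ Metric.ball x d,
      Real.log (1 + (‖x‖ - d)) * (ε / 2) ≤ Real.log (1 + ‖y‖) * g y := by
    intro y hy
    rw [Metric.mem_ball, dist_eq_norm] at hy
    have h1 := (abs_le.1 (hm (ε / 2) (half_pos hε) y x hy.le)).1
    have h2 : ‖x‖ - d ≤ ‖y‖ := by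
      have := norm_sub_norm_le x y
      rw [norm_sub_rev] at this
      linarith
    have h3 : Real.log (1 + (‖x‖ - d)) ≤ Real.log (1 + ‖y‖) :=
      Real.log_le_log (by linarith) (by linarith)
    exact mul_le_mul h3 (by linarith) (half_pos hε).le (log_one_add_norm_nonneg y)
  have h4 := setIntegral_mono_on (μ := volume) (integrableOn_const measure_ball_lt_top.ne)
    hg.logInt.integrableOn
    (measurableSet_ball (x := x) (ε := d)) hlow
  rw [setIntegral_const, smul_eq_mul] at h4
  have h5 : volume.real (Metric.ball x d) = V := by
    rw [hV, Measure.real, Measure.real, Measure.addHaar_ball_center]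
  have h6 := setIntegral_le_integral hg.logInt (s := Metric.ball x d)
    (Eventually.of_forall fun y => mul_nonneg (log_one_add_norm_nonneg y) (hg.nonneg y))
  rw [h5] at h4
  linarith

/-- Sequential compactness in the uniform topology. -/
lemma exists_uniform_limit {δ : ℝ → ℝ} (hδ : ∀ ε, 0 < ε → 0 < δ ε) {B C : ℝ}
    {g : ℕ → Plane → ℝ} (hm : ∀ n, HasModulus δ (g n)) (hg : ∀ n, Admissible (g n))
    (hC : ∀ n x, g n x ≤ C) (hB : ∀ n, ∫ x, Real.log (1 + ‖x‖) * g n x ≤ B) :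
    ∃ (f : Plane → ℝ) (φ : ℕ → ℕ), StrictMono φ ∧ HasModulus δ f ∧ (∀ x, 0 ≤ f x) ∧
      ∀ n x, |g (φ n) x - f x| ≤ 1 / ((n : ℝ) + 1) := by
  have hcpt : IsCompact (univ.pi fun _ : Plane => Icc (0 : ℝ) C) :=
    isCompact_univ_pi fun _ => isCompact_Icc
  -- Tychonoff's theorem gives a pointwise limit along a nonprincipal ultrafilter; equicontinuity
  -- and uniform decay upgrade it to a uniform one.
  obtain ⟨f, hf, hUf⟩ := hcpt.ultrafilter_le_nhds ((hyperfilter ℕ).map g) (by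
    rw [Ultrafilter.coe_map, le_principal_iff]
    exact mem_map.2 (univ_mem' fun n x _ => ⟨(hg n).nonneg x, hC n x⟩))
  have hpt : ∀ x, Tendsto (fun n => g n x) (hyperfilter ℕ) (𝓝 (f x)) := fun x =>
    tendsto_pi_nhds.1 (show Tendsto g (hyperfilter ℕ) (𝓝 f) from hUf) x
  have hf0 : ∀ x, 0 ≤ f x := fun x => (hf x trivial).1
  have hmf : HasModulus δ f := fun ε hε x y hxy =>
    le_of_tendsto ((hpt x).sub (hpt y)).abs (Eventually.of_forall fun n => hm n ε hε x y hxy)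
  have huni : ∀ ε : ℝ, 0 < ε → ∀ᶠ n in (hyperfilter ℕ : Filter ℕ), ∀ x, |g n x - f x| ≤ ε := by
    intro ε hε
    have hε3 : 0 < ε / 3 := by positivity
    obtain ⟨ρ, hρ⟩ := exists_uniform_decay hδ B hε3
    -- A finite net controls the ball of radius `ρ`; outside it all the functions are small.
    obtain ⟨t, -, htf, ht⟩ := (isCompact_closedBall (0 : Plane) ρ).finite_cover_balls (hδ _ hε3)
    have hfin : ∀ᶠ n in (hyperfilter ℕ : Filter ℕ), ∀ y ∈ t, |g n y - f y| < ε / 3 := by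
      rw [eventually_all_finite htf]
      intro y _
      have := (hpt y).sub_const (f y)
      rw [sub_self] at this
      have := this.abs
      rw [abs_zero] at this
      exact this.eventually (gt_mem_nhds hε3)
    filter_upwards [hfin] with n hn x
    rcases le_total ρ ‖x‖ with hx | hx
    · have h1 := hρ (g n) (hm n) (hg n) (hB n) x hx
      have h2 : f x ≤ ε / 3 := le_of_tendsto (hpt x)
        (Eventually.of_forall fun k => hρ (g k) (hm k) (hg k) (hB k) x hx)
      rw [abs_le]
      constructor <;> linarith [hf0 x, (hg n).nonneg x]
    · have hx' : x ∈ ⋃ y ∈ t, Metric.ball y (δ (ε / 3)) := ht (by simpa using hx)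
      simp only [mem_iUnion, Metric.mem_ball, dist_eq_norm] at hx'
      obtain ⟨y, hy, hxy⟩ := hx'
      have h1 := abs_le.1 (hm n _ hε3 x y hxy.le)
      have h2 := abs_le.1 (hmf _ hε3 x y hxy.le)
      have h3 := abs_lt.1 (hn y hy)
      rw [abs_le]
      constructor <;> linarith
  obtain ⟨φ, hφ, hφ'⟩ := extraction_forall_of_frequently (P := fun n k =>
    ∀ x, |g k x - f x| ≤ 1 / ((n : ℝ) + 1)) fun n =>
      ((huni _ (by positivity)).frequently).filter_mono Nat.hyperfilter_le_atTop
  exact ⟨f, φ, hφ, hmf, hf0, hφ'⟩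

/-! ### Continuity of the singular part of the interaction -/

lemma integral_posLog_inv_mul {f : Plane → ℝ} (hf : Integrable f) :
    Integrable (fun p : Plane × Plane => Real.posLog ‖p.1 - p.2‖⁻¹ * f p.2) ∧
    ∫ p : Plane × Plane, Real.posLog ‖p.1 - p.2‖⁻¹ * f p.2 =
      (∫ z : Plane, Real.posLog ‖z‖⁻¹) * ∫ x, f x := by
  have hi : Integrable (fun p : Plane × Plane => Real.posLog ‖p.1 - p.2‖⁻¹ * f p.2) :=
    (hf.convolution_integrand (μ := volume) (ContinuousLinearMap.mul ℝ ℝ)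
      integrable_posLog_inv_norm).congr (Eventually.of_forall fun p => by
        simp [mul_comm])
  refine ⟨hi, ?_⟩
  rw [Measure.volume_eq_prod, integral_prod_symm _ hi, ← integral_const_mul]
  refine integral_congr_ae (Eventually.of_forall fun y => ?_)
  simp only
  rw [integral_mul_const, integral_sub_right_eq_self (fun z : Plane => Real.posLog ‖z‖⁻¹) y]

/-- Writing `f(x)f(y) - g(x)g(y) = (f-g)(x) f(y) + g(x) (f-g)(y)` leaves one free variable in each
error term, and the kernel is integrable in it. -/
lemma integral_posLog_inv_le {f g : Plane → ℝ} (hf : Admissible f) (hg : Admissible g)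
    {ε : ℝ} (hfg : ∀ x, |f x - g x| ≤ ε) :
    ∫ p : Plane × Plane, Real.posLog ‖p.1 - p.2‖⁻¹ * f p.1 * f p.2 ≤
      (∫ p : Plane × Plane, Real.posLog ‖p.1 - p.2‖⁻¹ * g p.1 * g p.2) +
        ε * ((∫ z : Plane, Real.posLog ‖z‖⁻¹) * (mass f + mass g)) := by
  obtain ⟨i1, e1⟩ := integral_posLog_inv_mul hf.int
  obtain ⟨i2, e2⟩ := integral_posLog_inv_mul hg.int
  have i3 := i2.swap
  have e3 := integral_prod_swap (μ := volume) (ν := volume)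
    fun p : Plane × Plane => Real.posLog ‖p.1 - p.2‖⁻¹ * g p.2
  rw [← Measure.volume_eq_prod, e2] at e3
  have e : ε * ((∫ z : Plane, Real.posLog ‖z‖⁻¹) * (mass f + mass g)) =
      ∫ p : Plane × Plane, ε * (Real.posLog ‖p.1 - p.2‖⁻¹ * f p.2 +
        Real.posLog ‖p.swap.1 - p.swap.2‖⁻¹ * g p.swap.2) := by
    rw [integral_const_mul]
    have := integral_add i1 i3
    simp only [Function.comp_def] at this
    rw [this, e1, e3, mass, mass]
    ring
  have e4 := integral_add hg.integrable_posLog_inv ((i1.add i3).const_mul ε)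
  simp only [Pi.add_apply, Function.comp_apply] at e4
  rw [e, ← e4]
  refine integral_mono hf.integrable_posLog_inv
    (hg.integrable_posLog_inv.add ((i1.add i3).const_mul ε)) fun p => ?_
  simp only [Prod.fst_swap, Prod.snd_swap]
  rw [norm_sub_rev p.2 p.1]
  have h0 : 0 ≤ Real.posLog ‖p.1 - p.2‖⁻¹ := Real.posLog_nonneg
  have h1 := (abs_le.1 (hfg p.1)).2
  have h2 := (abs_le.1 (hfg p.2)).2
  have h3 : f p.1 * f p.2 ≤ g p.1 * g p.2 + ε * (f p.2 + g p.1) := by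
    nlinarith [mul_le_mul_of_nonneg_right h1 (hf.nonneg p.2),
      mul_le_mul_of_nonneg_left h2 (hg.nonneg p.1)]
  nlinarith [mul_le_mul_of_nonneg_left h3 h0]


/-! ### Minimizing the moment among improvements -/

/-- The equimeasurable rearrangements of `ω` with modulus of continuity `δ` that have at most
the logarithmic moment and at least the energy of `ω`. -/
structure Improvement (δ : ℝ → ℝ) (ω g : Plane → ℝ) : Prop where
  adm : Admissible g
  modulus : HasModulus δ g
  h_eq : ∀ a : ℝ, 0 < a → h a g = h a ω
  moment_le : ∫ x, Real.log (1 + ‖x‖) * g x ≤ ∫ x, Real.log (1 + ‖x‖) * ω x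
  energy_le : energy ω ≤ energy g

lemma Admissible.lintegral_log {g : Plane → ℝ} (hg : Admissible g) :
    ∫⁻ x, ENNReal.ofReal (Real.log (1 + ‖x‖) * g x) =
      ENNReal.ofReal (∫ x, Real.log (1 + ‖x‖) * g x) :=
  (ofReal_integral_eq_lintegral_ofReal hg.logInt
    (Eventually.of_forall fun x => mul_nonneg (log_one_add_norm_nonneg x) (hg.nonneg x))).symm

lemma Improvement.polarize {δ : ℝ → ℝ} (hδ : ∀ ε, 0 < ε → 0 < δ ε) {ω g : Plane → ℝ}
    (hg : Improvement δ ω g) {u : Plane} {c : ℝ} (hu : ‖u‖ = 1) (hc : 0 ≤ c) :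
    Improvement δ ω (polarize u c g) := by
  have hcont := (hg.modulus.polarize (c := c) hu).continuous hδ
  have hh : ∀ a : ℝ, 0 < a → h a (PlanarVortex.polarize u c g) = h a g := fun a _ =>
    h_polarize hu hg.adm.cont hcont a
  have hadm : Admissible (PlanarVortex.polarize u c g) := by
    refine hg.adm.of_h_eq hcont (polarize_nonneg hg.adm.nonneg) hh ?_
    -- The moment of the polarized function is not yet known to be finite, so it is dominated
    -- pointwise by the pair sum for `g`.
    have hfin : ∫⁻ x, ENNReal.ofReal (Real.log (1 + ‖x‖) * g x +
        Real.log (1 + ‖lineRefl u c x‖) * g (lineRefl u c x)) < ⊤ :=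
      (integral_twoPoint_log (c := c) hu hg.adm).1.lintegral_lt_top
    refine lt_of_le_of_lt (lintegral_mono fun x => ENNReal.ofReal_le_ofReal ?_) hfin
    refine le_trans ?_ (twoPoint_log_polarize_le (g := g) hu hc x)
    exact le_add_of_nonneg_right (mul_nonneg (log_one_add_norm_nonneg _)
      (polarize_nonneg hg.adm.nonneg _))
  exact ⟨hadm, hg.modulus.polarize hu, fun a ha => (hh a ha).trans (hg.h_eq a ha),
    (integral_log_polarize_le hu hc hg.adm hadm).trans hg.moment_le,
    hg.energy_le.trans (energy_le_energy_polarize hu hg.adm hadm)⟩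

/-- Lower semicontinuity of the logarithmic interaction under uniform convergence. -/
lemma integral_energyDensity_le_of_tendsto {f : Plane → ℝ} {g : ℕ → Plane → ℝ}
    (hf : Admissible f) (hg : ∀ n, Admissible (g n)) (hmass : ∀ n, mass (g n) = mass f)
    (hlim : ∀ n x, |g n x - f x| ≤ 1 / ((n : ℝ) + 1)) {b : ℝ}
    (hb : ∀ n, ∫ p, energyDensity (g n) p ≤ b) : ∫ p, energyDensity f p ≤ b := by
  set P : (Plane → ℝ) → ℝ := fun k =>
    ∫ p : Plane × Plane, Real.posLog ‖p.1 - p.2‖ * k p.1 * k p.2 with hP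
  set N : (Plane → ℝ) → ℝ := fun k =>
    ∫ p : Plane × Plane, Real.posLog ‖p.1 - p.2‖⁻¹ * k p.1 * k p.2 with hN
  have hsplit : ∀ k, Admissible k → ∫ p, energyDensity k p = P k - N k := fun k hk => by
    simp only [energyDensity_eq]
    exact integral_sub hk.integrable_posLog hk.integrable_posLog_inv
  have hnn : ∀ k, Admissible k → ∀ p : Plane × Plane,
      0 ≤ Real.posLog ‖p.1 - p.2‖ * k p.1 * k p.2 := fun k hk p =>
    mul_nonneg (mul_nonneg Real.posLog_nonneg (hk.nonneg _)) (hk.nonneg _)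
  set K := (∫ z : Plane, Real.posLog ‖z‖⁻¹) * (mass f + mass f) with hK
  -- The singular part `N` is controlled by uniform distance at fixed mass; the far part `P` is
  -- nonnegative and is left to Fatou's lemma.
  have hbn : ∀ n : ℕ, P (g n) ≤ b + N f + 1 / ((n : ℝ) + 1) * K := fun n => by
    have h1 := hb n
    have h2 := integral_posLog_inv_le (hg n) hf (hlim n)
    rw [hsplit _ (hg n)] at h1
    rw [hmass n] at h2
    linarith
  have htend : Tendsto (fun n : ℕ => b + N f + 1 / ((n : ℝ) + 1) * K) atTop (𝓝 (b + N f)) := by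
    simpa using (tendsto_one_div_add_atTop_nhds_zero_nat.mul_const K).const_add (b + N f)
  have h0 : 0 ≤ b + N f := ge_of_tendsto htend (Eventually.of_forall fun n =>
    le_trans (integral_nonneg (hnn _ (hg n))) (hbn n))
  have hpt : ∀ x, Tendsto (fun n => g n x) atTop (𝓝 (f x)) := fun x => by
    rw [tendsto_iff_dist_tendsto_zero]
    exact squeeze_zero (fun _ => dist_nonneg) (fun n => hlim n x)
      tendsto_one_div_add_atTop_nhds_zero_nat
  have hfat := lintegral_le_of_tendsto_of_le (μ := volume)
    (F := fun n (p : Plane × Plane) =>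
      ENNReal.ofReal (Real.posLog ‖p.1 - p.2‖ * g n p.1 * g n p.2))
    (G := fun p => ENNReal.ofReal (Real.posLog ‖p.1 - p.2‖ * f p.1 * f p.2))
    (fun n => (((measurable_posLog.comp (measurable_fst.sub measurable_snd).norm).mul
      ((hg n).cont.measurable.comp measurable_fst)).mul
      ((hg n).cont.measurable.comp measurable_snd)).ennreal_ofReal)
    (fun p => (ENNReal.continuous_ofReal.tendsto _).comp
      (((hpt p.1).const_mul _).mul (hpt p.2)))
    (fun n => by
      rw [← ofReal_integral_eq_lintegral_ofReal (hg n).integrable_posLog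
        (Eventually.of_forall (hnn _ (hg n)))]
      exact ENNReal.ofReal_le_ofReal (hbn n))
    ((ENNReal.continuous_ofReal.tendsto _).comp htend)
  rw [← ofReal_integral_eq_lintegral_ofReal hf.integrable_posLog
    (Eventually.of_forall (hnn _ hf)), ENNReal.ofReal_le_ofReal_iff h0] at hfat
  rw [hsplit _ hf]
  linarith

/-- There is an improvement of `ω` with the least logarithmic moment. -/
lemma exists_improvement_min {δ : ℝ → ℝ} (hδ : ∀ ε, 0 < ε → 0 < δ ε) {ω : Plane → ℝ}
    (hω : Admissible ω) (hm : HasModulus δ ω) :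
    ∃ f, Improvement δ ω f ∧ ∀ g, Improvement δ ω g →
      ∫ x, Real.log (1 + ‖x‖) * f x ≤ ∫ x, Real.log (1 + ‖x‖) * g x := by
  set S : Set ℝ := (fun g : Plane → ℝ => ∫ x, Real.log (1 + ‖x‖) * g x) '' {g | Improvement δ ω g}
    with hS
  have hne : S.Nonempty := ⟨_, ω, ⟨hω, hm, fun _ _ => rfl, le_rfl, le_rfl⟩, rfl⟩
  have hbd : BddBelow S := by
    refine ⟨0, ?_⟩
    rintro _ ⟨g, hg, rfl⟩
    exact integral_nonneg fun x => mul_nonneg (log_one_add_norm_nonneg x) (hg.adm.nonneg x)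
  obtain ⟨v, -, hv, hvS⟩ := exists_seq_tendsto_sInf hne hbd
  choose g hg hgv using hvS
  have hg : ∀ n, Improvement δ ω (g n) := hg
  simp only at hgv
  obtain ⟨C, hC⟩ := hω.bdd
  have hC' : ∀ n x, g n x ≤ max C 1 := fun n => le_of_h_eq_zero (hg n).adm.cont (by
    rw [(hg n).h_eq _ (by positivity)]
    exact h_eq_zero_of_le fun x => (hC x).trans (le_max_left _ _))
  obtain ⟨f, φ, hφ, hmf, hf0, hlim⟩ := exists_uniform_limit hδ (fun n => (hg n).modulus)
    (fun n => (hg n).adm) hC' (fun n => (hg n).moment_le)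
  have hcont := hmf.continuous hδ
  have hfh : ∀ a : ℝ, 0 < a → h a f = h a ω := h_eq_of_forall_approx fun ε hε => by
    obtain ⟨n, hn⟩ := exists_nat_one_div_lt hε
    exact ⟨g (φ n), fun x => (hlim n x).trans hn.le, (hg _).h_eq⟩
  have hpt : ∀ x, Tendsto (fun n => g (φ n) x) atTop (𝓝 (f x)) := fun x => by
    rw [tendsto_iff_dist_tendsto_zero]
    exact squeeze_zero (fun _ => dist_nonneg) (fun n => hlim n x)
      tendsto_one_div_add_atTop_nhds_zero_nat
  -- One use of Fatou's lemma gives both finiteness of the limit's moment and its minimality.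
  have hfat : ∫⁻ x, ENNReal.ofReal (Real.log (1 + ‖x‖) * f x) ≤ ENNReal.ofReal (sInf S) :=
    lintegral_le_of_tendsto_of_le
      (F := fun n x => ENNReal.ofReal (Real.log (1 + ‖x‖) * g (φ n) x))
      (fun n => (continuous_log_one_add_norm.mul (hg (φ n)).adm.cont).measurable.ennreal_ofReal)
      (fun x => (ENNReal.continuous_ofReal.tendsto _).comp ((hpt x).const_mul _))
      (fun n => by rw [(hg (φ n)).adm.lintegral_log, hgv]; exact le_rfl)
      ((ENNReal.continuous_ofReal.tendsto _).comp (hv.comp hφ.tendsto_atTop))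
  have hadm : Admissible f := hω.of_h_eq hcont hf0 hfh (hfat.trans_lt ENNReal.ofReal_lt_top)
  have hinf0 : 0 ≤ sInf S := le_csInf hne fun _ hs => by
    obtain ⟨g, hg, rfl⟩ := hs
    exact integral_nonneg fun x => mul_nonneg (log_one_add_norm_nonneg x) (hg.adm.nonneg x)
  rw [hadm.lintegral_log, ENNReal.ofReal_le_ofReal_iff hinf0] at hfat
  have hmin : ∀ k, Improvement δ ω k →
      ∫ x, Real.log (1 + ‖x‖) * f x ≤ ∫ x, Real.log (1 + ‖x‖) * k x := fun k hk =>
    hfat.trans (csInf_le hbd ⟨k, hk, rfl⟩)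
  refine ⟨f, ⟨hadm, hmf, hfh, hmin ω ⟨hω, hm, fun _ _ => rfl, le_rfl, le_rfl⟩, ?_⟩, hmin⟩
  rw [hω.energy_le_energy_iff hadm]
  refine integral_energyDensity_le_of_tendsto hadm (fun n => (hg (φ n)).adm) (fun n => ?_) hlim
    fun n => (hω.energy_le_energy_iff (hg (φ n)).adm).1 (hg (φ n)).energy_le
  exact (hg (φ n)).adm.mass_eq hadm fun a ha => ((hg (φ n)).h_eq a ha).trans (hfh a ha).symm

/-- A continuous function that is not increased by any reflection away from the origin is
symmetric decreasing. -/
lemma isSymmDecreasing_of_lineRefl_le {g : Plane → ℝ} (hg : Continuous g)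
    (hr : ∀ (u : Plane) (c : ℝ), ‖u‖ = 1 → 0 < c → ∀ x, lineDist u c x < 0 →
      g (lineRefl u c x) ≤ g x) : IsSymmDecreasing g := by
  have hlt : ∀ x y : Plane, ‖x‖ < ‖y‖ → g y ≤ g x := by
    intro x y hxy
    have hne : y - x ≠ 0 := sub_ne_zero.2 fun h => by rw [h] at hxy; exact lt_irrefl _ hxy
    have hr0 : 0 < ‖y - x‖ := norm_pos_iff.2 hne
    set r := ‖y - x‖ with hrdef
    have hsq : r ^ 2 = ‖y‖ ^ 2 - 2 * inner ℝ y x + ‖x‖ ^ 2 := norm_sub_sq_real y x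
    -- The line is the perpendicular bisector of `x` and `y`; its offset is positive because `‖x‖ <
    -- ‖y‖`.
    have hu : ‖r⁻¹ • (y - x)‖ = 1 := by
      rw [norm_smul, norm_inv, Real.norm_of_nonneg hr0.le, inv_mul_cancel₀ hr0.ne']
    have hc : 0 < (‖y‖ ^ 2 - ‖x‖ ^ 2) / (2 * r) := by
      have : ‖x‖ ^ 2 < ‖y‖ ^ 2 := by nlinarith [norm_nonneg x]
      apply div_pos <;> linarith
    have hd : lineDist (r⁻¹ • (y - x)) ((‖y‖ ^ 2 - ‖x‖ ^ 2) / (2 * r)) x = -(r / 2) := by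
      rw [lineDist, inner_smul_right, inner_sub_right, real_inner_self_eq_norm_sq,
        real_inner_comm]
      field_simp
      linarith
    have href : lineRefl (r⁻¹ • (y - x)) ((‖y‖ ^ 2 - ‖x‖ ^ 2) / (2 * r)) x = y := by
      rw [lineRefl, hd, smul_smul, show 2 * -(r / 2) * r⁻¹ = -1 by field_simp]
      module
    have := hr _ _ hu hc x (by rw [hd]; linarith)
    rwa [href] at this
  intro x y hxy
  rcases eq_or_ne y 0 with rfl | hy
  · rw [norm_zero] at hxy
    rw [norm_le_zero_iff.1 hxy]
  · have hty : Tendsto (fun t : ℝ => g (t • x)) (𝓝[<] 1) (𝓝 (g ((1 : ℝ) • x))) :=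
      ((hg.comp (continuous_id.smul continuous_const)).tendsto (1 : ℝ)).mono_left
        nhdsWithin_le_nhds
    rw [one_smul] at hty
    refine ge_of_tendsto hty ?_
    filter_upwards [Ioo_mem_nhdsLT (zero_lt_one' ℝ)] with t ht
    refine hlt _ _ ?_
    rw [norm_smul, Real.norm_of_nonneg ht.1.le]
    have := norm_pos_iff.2 hy
    nlinarith [ht.1, ht.2, norm_nonneg x]

lemma Admissible.h_ne_top {g : Plane → ℝ} (hg : Admissible g) {a : ℝ} (ha : 0 < a) :
    h a g ≠ ⊤ := by
  refine (lt_of_le_of_lt (measure_mono fun x hx => ?_) (hg.int.measure_ge_lt_top ha)).ne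
  exact (show a < g x from hx).le

/-- Positivity comes from areas: if `g y ≤ 0`, every set `{g > a}` with `a > 0` lies in the ball of
radius `‖y‖`, so `{ω > 0}`, which is the whole plane, would have finite area. Decay follows from the
modulus and the moment of `g`. -/
lemma mem_phaseSpace_of_isSymmDecreasing {ω g : Plane → ℝ} (hω : ω ∈ phaseSpace)
    (hg : Admissible g) (hs : IsSymmDecreasing g) {δ : ℝ → ℝ} (hδ : ∀ ε, 0 < ε → 0 < δ ε)
    (hm : HasModulus δ g) (hh : ∀ a : ℝ, 0 < a → h a g = h a ω) : g ∈ phaseSpace := by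
  refine ⟨hg.cont, fun y => ?_, ?_, hg.int, hg.logInt⟩
  · by_contra! hy
    have hb : ∀ a : ℝ, 0 < a → h a ω ≤ volume (Metric.ball (0 : Plane) ‖y‖) := fun a ha => by
      rw [← hh a ha]
      refine measure_mono fun x hx => ?_
      rw [mem_ball_zero_iff]
      by_contra! hxy
      have := hs y x hxy
      simp only [mem_ofPred_eq] at hx
      linarith
    have h1 : h 0 ω ≤ volume (Metric.ball (0 : Plane) ‖y‖) :=
      h_le_of_forall_add fun ε hε => by rw [zero_add]; exact hb ε hε
    rw [h, show {x | 0 < ω x} = univ from eq_univ_of_forall hω.2.1,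
      measure_univ_of_isAddLeftInvariant, top_le_iff] at h1
    exact measure_ball_lt_top.ne h1
  · rw [Metric.tendsto_nhds]
    intro ε hε
    obtain ⟨ρ, hρ⟩ := exists_uniform_decay hδ (∫ x, Real.log (1 + ‖x‖) * g x) (half_pos hε)
    filter_upwards [(tendsto_norm_cocompact_atTop (E := Plane)).eventually_ge_atTop ρ] with x hx
    rw [Real.dist_eq, sub_zero, abs_of_nonneg (hg.nonneg x)]
    linarith [hρ g hm hg le_rfl x hx]

/-- Every function in the phase space has a symmetric decreasing rearrangement in the phase
space, and it has at least the same energy. -/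
theorem exists_symmDecreasing_energy_le {ω : Plane → ℝ} (hω : ω ∈ phaseSpace) :
    ∃ g ∈ phaseSpace, (∀ a : ℝ, 0 < a → h a g = h a ω) ∧ IsSymmDecreasing g ∧
      energy ω ≤ energy g := by
  obtain ⟨δ, hδ, hmω⟩ := exists_hasModulus hω.1 hω.2.2.1
  obtain ⟨g, hg, hmin⟩ := exists_improvement_min hδ (admissible_of_mem_phaseSpace hω) hmω
  have hs : IsSymmDecreasing g := isSymmDecreasing_of_lineRefl_le hg.adm.cont
    fun u c hu hc x hx =>
      have hp := hg.polarize hδ hu hc.le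
      lineRefl_le_of_moment_le hu hc hg.adm hp.adm (hmin _ hp) hx
  exact ⟨g, mem_phaseSpace_of_isSymmDecreasing hω hg.adm hs hδ hg.modulus hg.h_eq, hg.h_eq, hs,
    hg.energy_le⟩


/-! ### Logarithmic interaction of concentric discs -/

lemma integrable_log_norm_sub_prod (R S : ℝ) :
    Integrable (fun p : Plane × Plane => Real.log ‖p.1 - p.2‖)
      ((volume.restrict (Metric.ball (0 : Plane) R)).prod
        (volume.restrict (Metric.ball (0 : Plane) S))) := by
  have : IsFiniteMeasure (volume.restrict (Metric.ball (0 : Plane) R)) :=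
    isFiniteMeasure_restrict.2 measure_ball_lt_top.ne
  have : IsFiniteMeasure (volume.restrict (Metric.ball (0 : Plane) S)) :=
    isFiniteMeasure_restrict.2 measure_ball_lt_top.ne
  have h1 : Integrable (fun p : Plane × Plane => Real.posLog ‖p.1 - p.2‖⁻¹)
      ((volume.restrict (Metric.ball (0 : Plane) R)).prod
        (volume.restrict (Metric.ball (0 : Plane) S))) := by
    have := (integrable_const (μ := volume.restrict (Metric.ball (0 : Plane) S))
      (1 : ℝ)).convolution_integrand (μ := volume) (ContinuousLinearMap.mul ℝ ℝ)
      integrable_posLog_inv_norm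
    simp only [ContinuousLinearMap.mul_apply', one_mul] at this
    exact this.mono_measure (Measure.prod_mono Measure.restrict_le_self le_rfl)
  refine (h1.add (integrable_const (Real.log (1 + R) + Real.log (1 + S)))).mono' ?_ ?_
  · exact (Real.measurable_log.comp (measurable_fst.sub measurable_snd).norm).aestronglyMeasurable
  · rw [Measure.prod_restrict]
    refine (ae_restrict_iff' (measurableSet_ball.prod measurableSet_ball)).2
      (Eventually.of_forall fun p hp => ?_)
    have hx : ‖p.1‖ < R := mem_ball_zero_iff.1 hp.1
    have hy : ‖p.2‖ < S := mem_ball_zero_iff.1 hp.2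
    have h2 : Real.log (1 + ‖p.1‖) ≤ Real.log (1 + R) :=
      Real.log_le_log (by positivity) (by linarith)
    have h3 : Real.log (1 + ‖p.2‖) ≤ Real.log (1 + S) :=
      Real.log_le_log (by positivity) (by linarith)
    rw [Real.norm_eq_abs]
    simp only [Pi.add_apply]
    linarith [abs_log_le_posLog_add ‖p.1 - p.2‖, posLog_norm_sub_le p.1 p.2]

lemma integrableOn_log_norm_sub (x : Plane) (S : ℝ) :
    IntegrableOn (fun y => Real.log ‖x - y‖) (Metric.ball (0 : Plane) S) := by
  have h1 : Integrable fun y : Plane => Real.posLog ‖x - y‖⁻¹ :=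
    integrable_posLog_inv_norm.comp_sub_left x
  refine Integrable.mono' (h1.integrableOn.add (integrableOn_const
    (C := Real.log (1 + ‖x‖) + Real.log (1 + S)) measure_ball_lt_top.ne)) ?_ ?_
  · exact (Real.measurable_log.comp (measurable_const.sub measurable_id).norm).aestronglyMeasurable
  · refine (ae_restrict_iff' measurableSet_ball).2 (Eventually.of_forall fun y hy => ?_)
    have hy : ‖y‖ < S := mem_ball_zero_iff.1 hy
    have h3 : Real.log (1 + ‖y‖) ≤ Real.log (1 + S) :=
      Real.log_le_log (by positivity) (by linarith)
    rw [Real.norm_eq_abs]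
    simp only [Pi.add_apply]
    linarith [abs_log_le_posLog_add ‖x - y‖, posLog_norm_sub_le x y]

/-- The isometry of the plane with the complex numbers. -/
def planeEquivComplex : Plane ≃ₗᵢ[ℝ] ℂ := Complex.orthonormalBasisOneI.repr.symm

/-- Rotation of the plane by the angle `θ`. -/
def planeRot (θ : ℝ) : Plane ≃ₗᵢ[ℝ] Plane :=
  (planeEquivComplex.trans (rotation (Circle.exp θ))).trans planeEquivComplex.symm

lemma planeRot_apply (θ : ℝ) (y : Plane) :
    planeRot θ y = planeEquivComplex.symm (Complex.exp (θ * Complex.I) * planeEquivComplex y) := by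
  simp [planeRot, Circle.coe_exp]

lemma continuous_planeRot : Continuous fun p : ℝ × Plane => planeRot p.1 p.2 := by
  simp only [planeRot_apply]
  have h1 := planeEquivComplex.continuous
  have h2 := planeEquivComplex.symm.continuous
  fun_prop

/-- The mean of `log|x - ·|` over the circle through `y` centred at the origin. -/
lemma integral_log_norm_sub_planeRot (x : Plane) {y : Plane} (hy : y ≠ 0) :
    ∫ θ in (0 : ℝ)..2 * Real.pi, Real.log ‖x - planeRot θ y‖ =
      2 * Real.pi * Real.log (max ‖x‖ ‖y‖) := by
  set w := planeEquivComplex x with hw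
  set z := planeEquivComplex y with hz
  have hny : 0 < ‖y‖ := norm_pos_iff.2 hy
  have hnz : ‖z‖ = ‖y‖ := planeEquivComplex.norm_map y
  have hnw : ‖w‖ = ‖x‖ := planeEquivComplex.norm_map x
  -- Rotating by `-arg z` puts `y` on the positive real axis, so that its orbit is exactly
  -- `circleMap 0 ‖y‖` with no phase shift.
  set a := Complex.exp (-(z.arg * Complex.I)) * w with ha
  have hna : ‖a‖ = ‖x‖ := by
    rw [ha, norm_mul, ← neg_mul, ← Complex.ofReal_neg, Complex.norm_exp_ofReal_mul_I, one_mul, hnw]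
  have hpt : ∀ θ : ℝ, ‖x - planeRot θ y‖ = ‖circleMap 0 ‖y‖ θ - a‖ := by
    intro θ
    have h1 : ‖x - planeRot θ y‖ = ‖w - Complex.exp (θ * Complex.I) * z‖ := by
      rw [← planeEquivComplex.norm_map (x - planeRot θ y), map_sub, planeRot_apply,
        LinearIsometryEquiv.apply_symm_apply]
    have h2 : circleMap 0 ‖y‖ θ - a =
        -(Complex.exp ((-z.arg : ℝ) * Complex.I) * (w - Complex.exp (θ * Complex.I) * z)) := by
      have h3 : z = ‖y‖ * Complex.exp (z.arg * Complex.I) := by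
        rw [← hnz]; exact (Complex.norm_mul_exp_arg_mul_I z).symm
      have h4 : Complex.exp ((-z.arg : ℝ) * Complex.I) * z = ‖y‖ := by
        calc Complex.exp ((-z.arg : ℝ) * Complex.I) * z
            = Complex.exp ((-z.arg : ℝ) * Complex.I) * (‖y‖ * Complex.exp (z.arg * Complex.I)) := by
              rw [← h3]
          _ = ‖y‖ := by
              rw [mul_left_comm, ← Complex.exp_add, ← add_mul]
              simp
      rw [ha, circleMap]
      push_cast at h4 ⊢
      rw [← neg_mul]
      linear_combination Complex.exp (θ * Complex.I) * (-h4)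
    rw [h1, h2, norm_neg, norm_mul, Complex.norm_exp_ofReal_mul_I, one_mul]
  have havg := circleAverage_log_norm_sub_const_eq_log_radius_add_posLog (a := a) (c := 0) hny.ne'
  rw [Real.circleAverage_def, zero_sub, norm_neg, hna, smul_eq_mul, inv_mul_eq_iff_eq_mul₀
    (by positivity)] at havg
  simp only [hpt]
  rw [havg]
  congr 1
  rcases le_total ‖x‖ ‖y‖ with h | h
  · rw [max_eq_right h, (Real.posLog_eq_zero_iff _).2, add_zero]
    rw [abs_of_nonneg (by positivity), inv_mul_le_iff₀ hny]
    linarith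
  · rw [max_eq_left h, Real.posLog_eq_log, Real.log_mul (inv_pos.2 hny).ne' (by linarith),
      Real.log_inv]
    · ring
    · rw [abs_of_nonneg (by positivity), le_inv_mul_iff₀ hny]
      linarith

/-- Newton's theorem: the logarithmic potential of a disc may be computed with the kernel
averaged over circles. -/
lemma integral_ball_log_norm_sub (x : Plane) (S : ℝ) :
    ∫ y in Metric.ball (0 : Plane) S, Real.log ‖x - y‖ =
      ∫ y in Metric.ball (0 : Plane) S, Real.log (max ‖x‖ ‖y‖) := by
  set B := Metric.ball (0 : Plane) S with hB
  have hfin : IsFiniteMeasure (volume.restrict B) :=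
    isFiniteMeasure_restrict.2 measure_ball_lt_top.ne
  have hpre : ∀ θ, planeRot θ ⁻¹' B = B := fun θ => by
    ext y; simp [hB]
  have hmp : ∀ θ, MeasurePreserving (planeRot θ) (volume.restrict B) (volume.restrict B) :=
    fun θ => by
      have := (planeRot θ).measurePreserving.restrict_preimage
        (measurableSet_ball (x := (0 : Plane)) (ε := S))
      rwa [← hB, hpre] at this
  have hmeas : Measurable fun y : Plane => Real.log ‖x - y‖ :=
    Real.measurable_log.comp (measurable_const.sub measurable_id).norm
  have hrot : ∀ (θ : ℝ) (F : Plane → ℝ), Measurable F →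
      ∫ y in B, F (planeRot θ y) = ∫ y in B, F y := fun θ F hF => by
    conv_rhs => rw [← (hmp θ).map_eq]
    exact (integral_map (hmp θ).measurable.aemeasurable hF.aestronglyMeasurable).symm
  have hjm : Measurable fun p : ℝ × Plane => Real.log ‖x - planeRot p.1 p.2‖ :=
    Real.measurable_log.comp (continuous_const.sub continuous_planeRot).norm.measurable
  have hint : Integrable (fun p : ℝ × Plane => Real.log ‖x - planeRot p.1 p.2‖)
      ((volume.restrict (Ioc 0 (2 * Real.pi))).prod (volume.restrict B)) := by
    rw [integrable_prod_iff hjm.aestronglyMeasurable]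
    refine ⟨Eventually.of_forall fun θ =>
      (hmp θ).integrable_comp_of_integrable (integrableOn_log_norm_sub x S), ?_⟩
    have : ∀ θ : ℝ, ∫ y in B, ‖Real.log ‖x - planeRot θ y‖‖ = ∫ y in B, ‖Real.log ‖x - y‖‖ :=
      fun θ => hrot θ _ hmeas.norm
    simp only [this]
    exact integrable_const _
  -- Averaging over all rotations leaves the integral over the disc unchanged, while for fixed `y`
  -- it produces the circle mean.
  have hswap := integral_integral_swap (f := fun θ y => Real.log ‖x - planeRot θ y‖) hint
  have hl : ∀ θ, ∫ y in B, Real.log ‖x - planeRot θ y‖ = ∫ y in B, Real.log ‖x - y‖ :=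
    fun θ => hrot θ _ hmeas
  have hr : ∀ᵐ y ∂(volume.restrict B), ∫ θ in Ioc 0 (2 * Real.pi), Real.log ‖x - planeRot θ y‖ =
      2 * Real.pi * Real.log (max ‖x‖ ‖y‖) := by
    have h0 : ∀ᵐ y : Plane ∂(volume.restrict B), y ≠ 0 :=
      ae_restrict_of_ae (by simp [ae_iff])
    filter_upwards [h0] with y hy
    rw [← integral_log_norm_sub_planeRot x hy, intervalIntegral.integral_of_le (by positivity)]
  rw [integral_congr_ae hr, integral_const_mul] at hswap
  simp only [hl] at hswap
  rw [setIntegral_const, Real.volume_real_Ioc_of_le (by positivity), sub_zero, smul_eq_mul]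
    at hswap
  exact mul_left_cancel₀ (by positivity) hswap

lemma volume_real_ball (R : ℝ) (hR : 0 ≤ R) (x : Plane) :
    volume.real (Metric.ball x R) = Real.pi * R ^ 2 := by
  rw [Measure.real, EuclideanSpace.volume_ball_fin_two, ENNReal.toReal_mul, ENNReal.toReal_pow,
    ENNReal.toReal_ofReal hR, ENNReal.toReal_ofReal Real.pi_pos.le, mul_comm]

/-- Integration of a radial function over a disc. -/
lemma setIntegral_ball_fun_norm {S : ℝ} (hS : 0 ≤ S) (f : ℝ → ℝ) :
    ∫ y in Metric.ball (0 : Plane) S, f ‖y‖ = 2 * Real.pi * ∫ t in (0 : ℝ)..S, t * f t := by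
  have h1 : (Metric.ball (0 : Plane) S).indicator (fun y => f ‖y‖) =
      fun y => (Iio S).indicator f ‖y‖ := by
    ext y
    by_cases h : ‖y‖ < S
    · rw [indicator_of_mem (mem_ball_zero_iff.2 h), indicator_of_mem (show ‖y‖ ∈ Iio S from h)]
    · rw [indicator_of_notMem (fun h' => h (mem_ball_zero_iff.1 h')),
        indicator_of_notMem (show ‖y‖ ∉ Iio S from h)]
  rw [← integral_indicator measurableSet_ball, h1, integral_fun_norm_addHaar,
    intervalIntegral.integral_of_le hS, volume_real_ball 1 zero_le_one]
  have h2 : ∀ t : ℝ, t ^ (Module.finrank ℝ Plane - 1) • (Iio S).indicator f t =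
      (Iio S).indicator (fun t => t * f t) t := by
    intro t
    by_cases h : t < S <;> simp [h]
  simp only [h2]
  rw [setIntegral_indicator measurableSet_Iio, Ioi_inter_Iio, integral_Ioc_eq_integral_Ioo]
  simp
  ring

/-- The antiderivative is continuous at `0`, so differentiability on the open interval suffices and
`ρ = 0` is allowed. -/
lemma integral_mul_log {ρ S : ℝ} (hρ : 0 ≤ ρ) (hS : ρ ≤ S) :
    ∫ t in ρ..S, t * Real.log t =
      (S ^ 2 / 2 * Real.log S - S ^ 2 / 4) - (ρ ^ 2 / 2 * Real.log ρ - ρ ^ 2 / 4) := by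
  have hc : Continuous fun t : ℝ => t ^ 2 / 2 * Real.log t - t ^ 2 / 4 := by
    have : (fun t : ℝ => t ^ 2 / 2 * Real.log t - t ^ 2 / 4) =
        fun t => t / 2 * (t * Real.log t) - t ^ 2 / 4 := by ext t; ring
    rw [this]
    exact ((continuous_id.div_const 2).mul Real.continuous_mul_log).sub (by fun_prop)
  refine intervalIntegral.integral_eq_sub_of_hasDerivAt_of_le hS hc.continuousOn
    (f := fun t : ℝ => t ^ 2 / 2 * Real.log t - t ^ 2 / 4) (fun t ht => ?_)
    (Real.continuous_mul_log.intervalIntegrable _ _)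
  have ht0 : t ≠ 0 := (lt_of_le_of_lt hρ ht.1).ne'
  have h1 : HasDerivAt (fun t : ℝ => t ^ 2) (2 * t) t := by simpa using hasDerivAt_pow 2 t
  refine (((h1.div_const 2).mul (Real.hasDerivAt_log ht0)).sub (h1.div_const 4)).congr_deriv ?_
  field_simp
  ring

lemma integral_ball_log_norm_sub_eq {x : Plane} {S : ℝ} (hx : ‖x‖ ≤ S) :
    ∫ y in Metric.ball (0 : Plane) S, Real.log ‖x - y‖ =
      Real.pi * S ^ 2 * Real.log S - Real.pi * (S ^ 2 - ‖x‖ ^ 2) / 2 := by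
  have h0 := norm_nonneg x
  have hS := h0.trans hx
  rw [integral_ball_log_norm_sub, setIntegral_ball_fun_norm hS fun t => Real.log (max ‖x‖ t)]
  have e1 : ∫ t in (0 : ℝ)..‖x‖, t * Real.log (max ‖x‖ t) = ‖x‖ ^ 2 / 2 * Real.log ‖x‖ := by
    rw [intervalIntegral.integral_congr (g := fun t => t * Real.log ‖x‖) fun t ht => ?_]
    · rw [intervalIntegral.integral_mul_const, integral_id]; ring
    · rw [uIcc_of_le h0] at ht
      simp only [max_eq_left ht.2]
  have e2 : ∫ t in ‖x‖..S, t * Real.log (max ‖x‖ t) = ∫ t in ‖x‖..S, t * Real.log t :=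
    intervalIntegral.integral_congr fun t ht => by
      rw [uIcc_of_le hx] at ht
      simp only [max_eq_right ht.1]
  have i1 : IntervalIntegrable (fun t => t * Real.log (max ‖x‖ t)) volume 0 ‖x‖ := by
    refine (Continuous.intervalIntegrable (u := fun t => t * Real.log ‖x‖) (by fun_prop) _ _).congr
      fun t ht => ?_
    rw [uIoc_of_le h0] at ht
    simp only [max_eq_left ht.2]
  have i2 : IntervalIntegrable (fun t => t * Real.log (max ‖x‖ t)) volume ‖x‖ S := by
    refine (Real.continuous_mul_log.intervalIntegrable _ _).congr fun t ht => ?_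
    rw [uIoc_of_le hx] at ht
    simp only [max_eq_right ht.1.le]
  rw [← intervalIntegral.integral_add_adjacent_intervals i1 i2, e1, e2, integral_mul_log h0 hx]
  ring

lemma integral_ball_ball_log_norm_sub {R S : ℝ} (hR : 0 ≤ R) (hRS : R ≤ S) :
    ∫ x in Metric.ball (0 : Plane) R, ∫ y in Metric.ball (0 : Plane) S, Real.log ‖x - y‖ =
      Real.pi ^ 2 * (R ^ 2 * S ^ 2 * Real.log S - R ^ 2 * S ^ 2 / 2 + R ^ 4 / 4) := by
  rw [setIntegral_congr_fun measurableSet_ball fun x hx =>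
    integral_ball_log_norm_sub_eq ((mem_ball_zero_iff.1 hx).le.trans hRS),
    setIntegral_ball_fun_norm hR
      fun t => Real.pi * S ^ 2 * Real.log S - Real.pi * (S ^ 2 - t ^ 2) / 2]
  have e : ∀ t : ℝ, t * (Real.pi * S ^ 2 * Real.log S - Real.pi * (S ^ 2 - t ^ 2) / 2) =
      (Real.pi * S ^ 2 * Real.log S - Real.pi * S ^ 2 / 2) * t + Real.pi / 2 * t ^ 3 := by
    intro t; ring
  simp only [e]
  rw [intervalIntegral.integral_add (Continuous.intervalIntegrable (by fun_prop) _ _)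
    (Continuous.intervalIntegrable (by fun_prop) _ _), intervalIntegral.integral_const_mul,
    intervalIntegral.integral_const_mul, integral_id, integral_pow]
  push_cast
  ring

/-- The logarithmic interaction of two concentric discs of areas `π r` and `π s`. -/
lemma integral_ball_ball_log_eq_L {r s : ℝ} (hr : 0 ≤ r) (hs : 0 ≤ s) :
    ∫ x in Metric.ball (0 : Plane) (√r), ∫ y in Metric.ball (0 : Plane) (√s), Real.log ‖x - y‖ =
      -(Real.pi ^ 2 / 2) * (L r s + r * s) := by
  have key : ∀ {r s : ℝ}, 0 ≤ r → 0 ≤ s → r ≤ s →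
      ∫ x in Metric.ball (0 : Plane) (√r), ∫ y in Metric.ball (0 : Plane) (√s), Real.log ‖x - y‖ =
      -(Real.pi ^ 2 / 2) * (L r s + r * s) := by
    intro r s hr hs hrs
    rw [integral_ball_ball_log_norm_sub (Real.sqrt_nonneg r) (Real.sqrt_le_sqrt hrs), L,
      max_eq_right hrs, min_eq_left hrs, show √r ^ 4 = (√r ^ 2) ^ 2 by ring, Real.sq_sqrt hr,
      Real.sq_sqrt hs, Real.log_sqrt hs]
    ring
  rcases le_total r s with h | h
  · exact key hr hs h
  · rw [integral_integral_swap (integrable_log_norm_sub_prod _ _)]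
    simp only [fun x y : Plane => norm_sub_rev x y]
    rw [key hs hr h, L, L, max_comm, min_comm]
    ring


/-! ### Layer-cake decomposition of the energy -/

/-- An open set of finite measure that is stable under decreasing the norm is a centred disc. -/
lemma eq_ball_of_norm_le_mem {U : Set Plane} (hU : IsOpen U) (hfin : volume U ≠ ⊤)
    (hs : ∀ x y, ‖x‖ ≤ ‖y‖ → y ∈ U → x ∈ U) :
    U = Metric.ball 0 (√(Real.pi⁻¹ * (volume U).toReal)) := by
  have hpi := Real.pi_pos
  ext x
  rw [mem_ball_zero_iff]
  constructor
  · intro hx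
    -- Openness yields a point of `U` farther out than `x`, which gives the strict inequality of an
    -- open disc.
    obtain ⟨y, hyU, hxy⟩ : ∃ y ∈ U, ‖x‖ < ‖y‖ := by
      by_contra! hcon
      have hsub : U ⊆ Metric.closedBall 0 ‖x‖ := fun y hy => by
        rw [mem_closedBall_zero_iff]; exact hcon y hy
      have hx' : x ∈ interior (Metric.closedBall (0 : Plane) ‖x‖) :=
        interior_mono hsub (hU.interior_eq.symm ▸ hx)
      rcases eq_or_ne x 0 with rfl | h0
      · simp at hx'
      · rw [interior_closedBall _ (norm_ne_zero_iff.2 h0), mem_ball_zero_iff] at hx'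
        exact lt_irrefl _ hx'
    have hsub : Metric.ball (0 : Plane) ‖y‖ ⊆ U := fun z hz =>
      hs z y (mem_ball_zero_iff.1 hz).le hyU
    have h1 := measureReal_mono (μ := volume) hsub hfin
    rw [volume_real_ball _ (norm_nonneg y)] at h1
    refine hxy.trans_le (Real.le_sqrt_of_sq_le ?_)
    rw [le_inv_mul_iff₀ hpi]
    exact h1
  · intro hx
    by_contra hxU
    have hsub : U ⊆ Metric.ball (0 : Plane) ‖x‖ := fun z hz => by
      rw [mem_ball_zero_iff]
      by_contra! h
      exact hxU (hs x z h hz)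
    have h1 := measureReal_mono (μ := volume) hsub measure_ball_lt_top.ne
    rw [volume_real_ball _ (norm_nonneg x)] at h1
    refine hx.not_ge ((Real.sqrt_le_left (norm_nonneg x)).2 ?_)
    rw [inv_mul_le_iff₀ hpi]
    exact h1

lemma superlevel_eq_ball {g : Plane → ℝ} (hg : Admissible g) (hs : IsSymmDecreasing g) {a : ℝ}
    (ha : 0 < a) : {x | a < g x} = Metric.ball 0 (√(hNorm g a)) :=
  eq_ball_of_norm_le_mem (isOpen_lt continuous_const hg.cont) (hg.h_ne_top ha)
    fun x y hxy hy => lt_of_lt_of_le hy (hs x y hxy)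

lemma hNorm_nonneg (g : Plane → ℝ) (a : ℝ) : 0 ≤ hNorm g a := by
  rw [hNorm]; positivity

lemma antitone_h (g : Plane → ℝ) : Antitone fun a => h a g := fun _ _ hab =>
  measure_mono fun _ hx => lt_of_le_of_lt hab hx

lemma Admissible.integrable_hNorm {g : Plane → ℝ} (hg : Admissible g) :
    IntegrableOn (hNorm g) (Ioi 0) := by
  have h1 : ∫⁻ a in Ioi (0 : ℝ), h a g ≠ ⊤ := by
    have := lintegral_eq_lintegral_meas_lt volume (Eventually.of_forall hg.nonneg)
      hg.cont.measurable.aemeasurable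
    rw [show ∫⁻ a in Ioi (0 : ℝ), h a g = ∫⁻ x, ENNReal.ofReal (g x) from this.symm]
    exact (lintegral_ofReal_ne_top_iff_integrable hg.cont.aestronglyMeasurable
      (Eventually.of_forall hg.nonneg)).2 hg.int
  exact (integrable_toReal_of_lintegral_ne_top (antitone_h g).measurable.aemeasurable h1).const_mul _

/-- The layer-cake formula for the mass. -/
lemma Admissible.mass_eq_integral_hNorm {g : Plane → ℝ} (hg : Admissible g) {m : ℝ} (hm0 : 0 ≤ m)
    (hm : ∀ x, g x ≤ m) : mass g = Real.pi * ∫ a in (0 : ℝ)..m, hNorm g a := by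
  rw [mass, hg.int.integral_eq_integral_meas_lt (Eventually.of_forall hg.nonneg),
    intervalIntegral.integral_of_le hm0, ← integral_const_mul]
  have e : ∀ a, Real.pi * hNorm g a = volume.real {x | a < g x} := fun a => by
    rw [hNorm, mul_inv_cancel_left₀ Real.pi_ne_zero]; rfl
  simp only [e]
  refine setIntegral_eq_of_subset_of_forall_sdiff_eq_zero measurableSet_Ioi
    (fun a ha => ha.1) fun a ha => ?_
  have ham : m ≤ a := by
    by_contra! h
    exact ha.2 ⟨ha.1, h.le⟩
  have := h_eq_zero_of_le (g := g) (a := a) fun x => (hm x).trans ham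
  rw [h] at this
  rw [Measure.real, this, ENNReal.toReal_zero]

/-- Indicator of the superlevel set `{a < g}`. -/
def layer (g : Plane → ℝ) (a : ℝ) (x : Plane) : ℝ := if a < g x then 1 else 0

lemma measurable_layer {g : Plane → ℝ} (hg : Continuous g) :
    Measurable fun p : ℝ × Plane => layer g p.1 p.2 :=
  Measurable.ite (measurableSet_lt measurable_fst (hg.measurable.comp measurable_snd))
    measurable_const measurable_const

lemma layer_nonneg (g : Plane → ℝ) (a : ℝ) (x : Plane) : 0 ≤ layer g a x := by
  unfold layer; split_ifs <;> norm_num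

lemma layer_eq_indicator (g : Plane → ℝ) (x : Plane) :
    (fun a => layer g a x) = (Iio (g x)).indicator fun _ => 1 := by
  ext a; simp [layer, indicator_apply]

lemma integrable_layer (g : Plane → ℝ) (m : ℝ) (x : Plane) :
    IntegrableOn (fun a => layer g a x) (Ioc 0 m) := by
  rw [layer_eq_indicator]
  exact (integrable_const _).indicator measurableSet_Iio

lemma integral_layer {g : Plane → ℝ} {m : ℝ} {x : Plane} (h0 : 0 ≤ g x) (hm : g x ≤ m) :
    ∫ a in Ioc 0 m, layer g a x = g x := by
  rw [layer_eq_indicator, setIntegral_indicator measurableSet_Iio, setIntegral_const, smul_eq_mul,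
    mul_one, show Ioc 0 m ∩ Iio (g x) = Ioo 0 (g x) by
      ext a
      simp only [mem_inter_iff, mem_Ioc, mem_Iio, mem_Ioo]
      exact ⟨fun h => ⟨h.1.1, h.2⟩, fun h => ⟨⟨h.1, h.2.le.trans hm⟩, h.2⟩⟩,
    Real.volume_real_Ioo_of_le h0, sub_zero]

/-- The energy density decomposed into layers. -/
def layerDensity (g : Plane → ℝ) (p : Plane × Plane) (q : ℝ × ℝ) : ℝ :=
  Real.log ‖p.1 - p.2‖ * (layer g q.1 p.1 * layer g q.2 p.2)

section Layers

variable {g : Plane → ℝ} {m : ℝ}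

lemma integral_layer_mul_layer (hg : Admissible g) (hm : ∀ x, g x ≤ m) (x y : Plane) :
    ∫ q : ℝ × ℝ, layer g q.1 x * layer g q.2 y
      ∂((volume.restrict (Ioc 0 m)).prod (volume.restrict (Ioc 0 m))) = g x * g y := by
  rw [integral_prod_mul (fun a => layer g a x) fun b => layer g b y,
    integral_layer (hg.nonneg x) (hm x), integral_layer (hg.nonneg y) (hm y)]

/-- Layers are nonnegative, so integrating the absolute value over the levels returns
`|energyDensity|`, which is integrable. -/
lemma integrable_layerDensity (hg : Admissible g) (hm : ∀ x, g x ≤ m) :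
    Integrable (Function.uncurry (layerDensity g))
      ((volume : Measure (Plane × Plane)).prod
        ((volume.restrict (Ioc 0 m)).prod (volume.restrict (Ioc 0 m)))) := by
  have hl := measurable_layer hg.cont
  have hmeas : Measurable (Function.uncurry (layerDensity g)) :=
    (Real.measurable_log.comp (measurable_fst.fst.sub measurable_fst.snd).norm).mul
      ((hl.comp (measurable_snd.fst.prodMk measurable_fst.fst)).mul
        (hl.comp (measurable_snd.snd.prodMk measurable_fst.snd)))
  rw [integrable_prod_iff hmeas.aestronglyMeasurable]
  refine ⟨Eventually.of_forall fun p =>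
    ((integrable_layer g m p.1).mul_prod (integrable_layer g m p.2)).const_mul
      (Real.log ‖p.1 - p.2‖), ?_⟩
  have : ∀ p : Plane × Plane, ∫ q, ‖Function.uncurry (layerDensity g) (p, q)‖
      ∂((volume.restrict (Ioc 0 m)).prod (volume.restrict (Ioc 0 m))) =
      ‖energyDensity g p‖ := by
    intro p
    have e : ∀ q : ℝ × ℝ, ‖Function.uncurry (layerDensity g) (p, q)‖ =
        ‖Real.log ‖p.1 - p.2‖‖ * (layer g q.1 p.1 * layer g q.2 p.2) := fun q => by
      rw [Function.uncurry_apply_pair, layerDensity, norm_mul, Real.norm_of_nonneg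
        (mul_nonneg (layer_nonneg _ _ _) (layer_nonneg _ _ _))]
    simp only [e]
    rw [integral_const_mul, integral_layer_mul_layer hg hm, energyDensity, mul_assoc, norm_mul,
      Real.norm_of_nonneg (mul_nonneg (hg.nonneg _) (hg.nonneg _))]
  simp only [this]
  exact hg.integrable_energyDensity.norm

lemma integral_layerDensity_snd (hg : Admissible g) (hm : ∀ x, g x ≤ m) (p : Plane × Plane) :
    ∫ q, layerDensity g p q
      ∂((volume.restrict (Ioc 0 m)).prod (volume.restrict (Ioc 0 m))) = energyDensity g p := by
  simp only [layerDensity]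
  rw [integral_const_mul, integral_layer_mul_layer hg hm, energyDensity, mul_assoc]

lemma integral_layerDensity_fst (hg : Admissible g) (hs : IsSymmDecreasing g) {q : ℝ × ℝ}
    (h1 : 0 < q.1) (h2 : 0 < q.2) :
    ∫ p, layerDensity g p q =
      -(Real.pi ^ 2 / 2) * (L (hNorm g q.1) (hNorm g q.2) + hNorm g q.1 * hNorm g q.2) := by
  rw [← integral_ball_ball_log_eq_L (hNorm_nonneg g _) (hNorm_nonneg g _),
    ← integral_prod _ (integrable_log_norm_sub_prod _ _), Measure.prod_restrict,
    ← integral_indicator (measurableSet_ball.prod measurableSet_ball),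
    ← superlevel_eq_ball hg hs h1, ← superlevel_eq_ball hg hs h2]
  refine integral_congr_ae (Eventually.of_forall fun p => ?_)
  by_cases k1 : q.1 < g p.1 <;> by_cases k2 : q.2 < g p.2 <;>
    simp [layerDensity, layer, k1, k2]

lemma ae_pos_prod_restrict (m : ℝ) :
    ∀ᵐ q : ℝ × ℝ ∂((volume.restrict (Ioc 0 m)).prod (volume.restrict (Ioc 0 m))),
      0 < q.1 ∧ 0 < q.2 := by
  rw [Measure.prod_restrict]
  exact (ae_restrict_iff' (measurableSet_Ioc.prod measurableSet_Ioc)).2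
    (Eventually.of_forall fun q hq => ⟨hq.1.1, hq.2.1⟩)

lemma integrable_hNorm_mul_hNorm (hg : Admissible g) (m : ℝ) :
    Integrable (fun q : ℝ × ℝ => hNorm g q.1 * hNorm g q.2)
      ((volume.restrict (Ioc 0 m)).prod (volume.restrict (Ioc 0 m))) := by
  have : IntegrableOn (hNorm g) (Ioc 0 m) := hg.integrable_hNorm.mono_set fun a ha => ha.1
  exact Integrable.mul_prod this this

/-- By Fubini, integrating the layer density over the plane variables gives an integrable function
of the levels. Up to a constant factor it is `L` plus the integrable product of the two areas. -/
lemma integrable_L_hNorm (hg : Admissible g) (hs : IsSymmDecreasing g) (hm : ∀ x, g x ≤ m) :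
    Integrable (fun q : ℝ × ℝ => L (hNorm g q.1) (hNorm g q.2))
      ((volume.restrict (Ioc 0 m)).prod (volume.restrict (Ioc 0 m))) := by
  have h1 := (integrable_layerDensity hg hm).integral_prod_right
  have h2 := ((h1.const_mul (-(2 / Real.pi ^ 2))).sub (integrable_hNorm_mul_hNorm hg m))
  refine h2.congr ?_
  filter_upwards [ae_pos_prod_restrict m] with q hq
  have := integral_layerDensity_fst hg hs hq.1 hq.2
  simp only [Pi.sub_apply, Function.uncurry_apply_pair]
  rw [this]
  have := Real.pi_pos
  field_simp
  ring

/-- The energy of a symmetric decreasing function in terms of its level areas. -/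
lemma energy_eq_energyFormula (hg : Admissible g) (hs : IsSymmDecreasing g) (hm0 : 0 ≤ m)
    (hm : ∀ x, g x ≤ m) : energy g = energyFormula g m := by
  have hL := integrable_L_hNorm hg hs hm
  have e1 : ∫ p, energyDensity g p = -(Real.pi ^ 2 / 2) *
      ((∫ q : ℝ × ℝ, L (hNorm g q.1) (hNorm g q.2)
        ∂((volume.restrict (Ioc 0 m)).prod (volume.restrict (Ioc 0 m)))) +
      ∫ q : ℝ × ℝ, hNorm g q.1 * hNorm g q.2
        ∂((volume.restrict (Ioc 0 m)).prod (volume.restrict (Ioc 0 m)))) := by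
    rw [← integral_add hL (integrable_hNorm_mul_hNorm hg m), ← integral_const_mul]
    simp only [← integral_layerDensity_snd hg hm]
    rw [integral_integral_swap (integrable_layerDensity hg hm)]
    refine integral_congr_ae ?_
    filter_upwards [ae_pos_prod_restrict m] with q hq
    exact integral_layerDensity_fst hg hs hq.1 hq.2
  have e2 : ∫ q : ℝ × ℝ, L (hNorm g q.1) (hNorm g q.2)
        ∂((volume.restrict (Ioc 0 m)).prod (volume.restrict (Ioc 0 m))) =
      ∫ a in (0 : ℝ)..m, ∫ b in (0 : ℝ)..m, L (hNorm g a) (hNorm g b) := by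
    simp only [intervalIntegral.integral_of_le hm0]
    exact integral_prod _ hL
  have e3 := integral_prod_mul (μ := volume.restrict (Ioc 0 m)) (ν := volume.restrict (Ioc 0 m))
    (hNorm g) (hNorm g)
  have e4 := hg.mass_eq_integral_hNorm hm0 hm
  rw [intervalIntegral.integral_of_le hm0] at e4
  -- The factors `-1/(4π)` and `-π²/2` combine to `π/8`, and `∫ ȟ = M₀/π` turns the product term
  -- into `M₀²/(8π)`.
  rw [hg.energy_eq, energyFormula, e1, e2, e3, e4]
  have := Real.pi_pos
  field_simp
  ring

end Layers

/-- The orbit only constrains positive levels; for `a ≤ 0` positivity makes both superlevel sets the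
whole plane. -/
lemma hNorm_eq_of_h_eq {f g : Plane → ℝ} (hf : ∀ x, 0 < f x) (hg : ∀ x, 0 < g x)
    (hh : ∀ a : ℝ, 0 < a → h a f = h a g) : hNorm f = hNorm g := by
  ext a
  rw [hNorm, hNorm]
  congr 2
  rcases le_or_gt a 0 with ha | ha
  · rw [h, h]
    congr 1
    ext x
    exact iff_of_true (ha.trans_lt (hf x)) (ha.trans_lt (hg x))
  · exact hh a ha


/-! ### The maximum over the orbit -/

lemma isGreatest_iSup_of_mem_phaseSpace {ω : Plane → ℝ} (hω : ω ∈ phaseSpace) :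
    IsGreatest (range ω) (⨆ x, ω x) := by
  obtain ⟨x, hx⟩ := exists_max_of_mem_phaseSpace hω
  have hg : IsGreatest (range ω) (ω x) := ⟨⟨x, rfl⟩, forall_mem_range.2 hx⟩
  rwa [iSup, hg.csSup_eq]

section Orbit

variable {ω₀ ω : Plane → ℝ} {m : ℝ}

lemma le_of_mem_orbit {Q : Set (Plane → ℝ)} (hQ : Q ⊆ phaseSpace)
    (hm : IsGreatest (range ω₀) m) (hm0 : 0 < m) (hω : ω ∈ orbit Q ω₀) (x : Plane) : ω x ≤ m := by
  refine le_of_h_eq_zero (hQ hω.1).1 ?_ x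
  rw [hω.2 m hm0]
  exact h_eq_zero_of_le fun y => hm.2 ⟨y, rfl⟩

/-- Symmetric decreasing elements of the orbit have the energy given by the formula. -/
lemma energy_eq_of_mem_orbit {Q : Set (Plane → ℝ)} (hQ : Q ⊆ phaseSpace) (hω₀ : ω₀ ∈ phaseSpace)
    (hm : IsGreatest (range ω₀) m) (hm0 : 0 < m) (hω : ω ∈ orbit Q ω₀)
    (hs : IsSymmDecreasing ω) : energy ω = energyFormula ω₀ m := by
  have hadm := admissible_of_mem_phaseSpace (hQ hω.1)
  rw [energy_eq_energyFormula hadm hs hm0.le (le_of_mem_orbit hQ hm hm0 hω), energyFormula,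
    energyFormula, hNorm_eq_of_h_eq (hQ hω.1).2.1 hω₀.2.1 hω.2,
    hadm.mass_eq (admissible_of_mem_phaseSpace hω₀) hω.2]

lemma energy_le_of_mem_orbit (hω₀ : ω₀ ∈ phaseSpace) (hm : IsGreatest (range ω₀) m) (hm0 : 0 < m)
    (hω : ω ∈ orbit phaseSpace ω₀) : energy ω ≤ energyFormula ω₀ m := by
  obtain ⟨g, hg, hh, hs, hle⟩ := exists_symmDecreasing_energy_le hω.1
  rwa [← energy_eq_of_mem_orbit Subset.rfl hω₀ hm hm0
    ⟨hg, fun a ha => (hh a ha).trans (hω.2 a ha)⟩ hs]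

lemma isGreatest_energy_orbit {Q : Set (Plane → ℝ)} (hQ : Q ⊆ phaseSpace) (hω₀ : ω₀ ∈ phaseSpace)
    (hm : IsGreatest (range ω₀) m) (hm0 : 0 < m) (hω : ω ∈ orbit Q ω₀)
    (hs : IsSymmDecreasing ω) : IsGreatest (energy '' orbit Q ω₀) (energyFormula ω₀ m) := by
  refine ⟨⟨ω, hω, energy_eq_of_mem_orbit hQ hω₀ hm hm0 hω hs⟩, ?_⟩
  rintro _ ⟨ω', hω', rfl⟩
  exact energy_le_of_mem_orbit hω₀ hm hm0 ⟨hQ hω'.1, hω'.2⟩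

end Orbit

end PlanarVortex

end

/-- Maximal energy over a rearrangement orbit. The phase space is the largest one (continuous
functions with the decay needed to define the energy); the last clause gives the same maximum over
any smaller class `Q` (smooth functions, faster decay, ...) that contains a radially symmetric
nonincreasing rearrangement of `ω₀`. -/
theorem proposition2p9 (ω₀ : PlanarVortex.Plane → ℝ) (hω₀ : ω₀ ∈ PlanarVortex.phaseSpace)
    (m : ℝ) (hm : m = ⨆ x, ω₀ x) :
    -- `m` is the maximum of `ω₀`, and `M₀ = π ∫₀ᵐ ȟ(a) da`
    IsGreatest (Set.range ω₀) m ∧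
    PlanarVortex.mass ω₀ = Real.pi * ∫ a in (0 : ℝ)..m, PlanarVortex.hNorm ω₀ a ∧
    -- both double integrals converge absolutely
    (∀ ω ∈ PlanarVortex.orbit PlanarVortex.phaseSpace ω₀,
      MeasureTheory.Integrable
        (fun p : PlanarVortex.Plane × PlanarVortex.Plane =>
          Real.log ‖p.1 - p.2‖ * ω p.1 * ω p.2)) ∧
    MeasureTheory.IntegrableOn
      (fun p : ℝ × ℝ =>
        PlanarVortex.L (PlanarVortex.hNorm ω₀ p.1) (PlanarVortex.hNorm ω₀ p.2))
      (Set.Icc 0 m ×ˢ Set.Icc 0 m) ∧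
    -- the maximum of the energy over the orbit exists and is given by the formula
    IsGreatest (PlanarVortex.energy '' PlanarVortex.orbit PlanarVortex.phaseSpace ω₀)
      (PlanarVortex.energyFormula ω₀ m) ∧
    -- it is attained at a radially symmetric nonincreasing function
    (∃ ω ∈ PlanarVortex.orbit PlanarVortex.phaseSpace ω₀,
      PlanarVortex.IsSymmDecreasing ω ∧
        PlanarVortex.energy ω = PlanarVortex.energyFormula ω₀ m) ∧
    -- the same maximum over the orbit within any smaller class containing such a function
    (∀ Q ⊆ PlanarVortex.phaseSpace,
      (∃ ω ∈ PlanarVortex.orbit Q ω₀, PlanarVortex.IsSymmDecreasing ω) →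
      IsGreatest (PlanarVortex.energy '' PlanarVortex.orbit Q ω₀)
        (PlanarVortex.energyFormula ω₀ m)) := by
  have hmax : IsGreatest (Set.range ω₀) m := by
    rw [hm]; exact PlanarVortex.isGreatest_iSup_of_mem_phaseSpace hω₀
  have hm0 : 0 < m := by
    obtain ⟨x, hx⟩ := hmax.1
    rw [← hx]; exact hω₀.2.1 x
  obtain ⟨g, hg, hh, hs, -⟩ := PlanarVortex.exists_symmDecreasing_energy_le hω₀
  have hgo : g ∈ PlanarVortex.orbit PlanarVortex.phaseSpace ω₀ := ⟨hg, hh⟩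
  have hgm := PlanarVortex.le_of_mem_orbit Set.Subset.rfl hmax hm0 hgo
  refine ⟨hmax, ?_, ?_, ?_, ?_, ?_, ?_⟩
  · exact (PlanarVortex.admissible_of_mem_phaseSpace hω₀).mass_eq_integral_hNorm hm0.le
      fun x => hmax.2 ⟨x, rfl⟩
  · exact fun ω hω => (PlanarVortex.admissible_of_mem_phaseSpace hω.1).integrable_energyDensity
  · rw [← PlanarVortex.hNorm_eq_of_h_eq hg.2.1 hω₀.2.1 hh, MeasureTheory.IntegrableOn,
      MeasureTheory.Measure.volume_eq_prod, ← MeasureTheory.Measure.prod_restrict,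
      ← MeasureTheory.restrict_Ioc_eq_restrict_Icc]
    exact PlanarVortex.integrable_L_hNorm (PlanarVortex.admissible_of_mem_phaseSpace hg) hs hgm
  · exact PlanarVortex.isGreatest_energy_orbit Set.Subset.rfl hω₀ hmax hm0 hgo hs
  · exact ⟨g, hgo, hs, PlanarVortex.energy_eq_of_mem_orbit Set.Subset.rfl hω₀ hmax hm0 hgo hs⟩
  · rintro Q hQ ⟨ω, hω, hωs⟩
    exact PlanarVortex.isGreatest_energy_orbit hQ hω₀ hmax hm0 hω hωs
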